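/- Let $\mathscr{H}^+$ be the ${}^+$stable limit DAHA: the $\mathbb{Q}(t,q)$-algebra generated by $T_i, X_i, Y_i$ ($i\ge 1$) with relations $T_iT_j=T_jT_i$ for $|i-j|>1$, $T_iT_{i+1}T_i=T_{i+1}T_iT_{i+1}$, $(T_i-1)(T_i+t)=0$; $tT_i^{-1}X_iT_i^{-1}=X_{i+1}$, $T_iX_j=X_jT_i$ for $j\ne i,i+1$, $X_iX_j=X_jX_i$; $t^{-1}T_iY_iT_i=Y_{i+1}$, $T_iY_j=Y_jT_i$ for $j\neq i,i+1$, $Y_iY_j=Y_jY_i$; and $Y_1T_1X_1=X_2Y_1T_1$. Let $\mathscr{P}_k^+=\mathbb{Q}(t,q)[x_1,\dots,x_k]$, and let $\mathscr{P}_\infty^+=\varprojlim\mathscr{P}_k^+$ be the inverse limit with respect to the maps $\mathscr{P}_{k}^+\to\mathscr{P}_{k-1}^+$, $x_k\mapsto 0$, taken either in the category of rings or in the category of graded rings (elements of bounded degree), with projections $\Pi_k:\mathscr{P}_\infty^+\to\mathscr{P}_k^+$. On $\mathscr{P}_k^+$ consider the operators $$T_if=s_if+(1-t)x_i\frac{f-s_if}{x_i-x_{i+1}}\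 (1\le i<k),\qquad \varpi_kf=\mathrm{pr}_1 f(x_2,\dots,x_k,qx_1),$$ where $s_i$ exchanges $x_i$ and $x_{i+1}$, and $\mathrm{pr}_1$ is the linear projection that fixes the monomials divisible by $x_1$ and kills the others, and the deformed Cherednik operators $$\widetilde Y^{(k)}_1=t^k\varpi_kT_{k-1}^{-1}\cdots T_1^{-1},\qquad \widetilde Y^{(k)}_{i+1}=t^{-1}T_i\widetilde Y^{(k)}_iT_i .$$ The operators $T_i$ and multiplication by $x_i$ are compatible with the inverse system and induce operators $\mathscr{T}_i,\mathscr{X}_i$ on $\mathscr{P}^+_\infty$. Let $\mathscr{P}(n)^+=\{F\in\mathscr{P}_\infty^+ : \mathscr{T}_iF=F \text{ for all } i>n\}$, and let $\mathscr{P}_{\rm as}^+=\bigcup_{n\ge0}\mathscr{P}(n)^+$ be the almost symmetric module. Scalars $a_k\in\mathbb{Q}(t,q)$ converge to $a$ if the order of vanishing of $a_k-a$ at $t=0$ tends to $+\infty$. A sequence $f_k\in\mathscr{P}_k^+$ (defined for large $k$) converges to $F\in\mathscr{P}_\infty^+$ if there are $h\in\mathscr{P}_\infty^+$, finitely many $g_1,\dots,g_N\in\mathscr{P}_{\rm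 as}^+$ and scalars $a_{j,k}\to a_j$ with $f_k=\Pi_kh+\sum_j a_{j,k}\Pi_kg_j$ for all large $k$ and $F=h+\sum_ja_jg_j$. Theorem. For each of the two versions of $\mathscr{P}_\infty^+$, there is one and only one $\mathscr{H}^+$-module structure on $\mathscr{P}_{\rm as}^+$ in which, for all $i\ge1$ and $F\in\mathscr{P}_{\rm as}^+$, $T_i$ and $X_i$ act as $\mathscr{T}_i$ and $\mathscr{X}_i$, and $Y_i$ acts as the limit operator $\mathscr{Y}_i F=\lim_k\widetilde Y_i^{(k)}\Pi_kF$ (this limit exists and lies in $\mathscr{P}_{\rm as}^+$). In other words, the limit operators $\mathscr{T}_i,\mathscr{X}_i,\mathscr{Y}_i$ are well-defined linear operators on $\mathscr{P}_{\rm as}^+$ that satisfy all the defining relations of $\mathscr{H}^+$; in particular the $\mathscr{Y}_i$ commute. -/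

import Mathlib

open Filter

noncomputable section

namespace StableDAHA

/-! ### The field `ℚ(t, q)` and the order of vanishing at `t = 0` -/

/-- The polynomial ring `ℚ[t, q]`. -/
abbrev Pol : Type := MvPolynomial (Fin 2) ℚ

/-- The field `ℚ(t, q)`. -/
abbrev K : Type := FractionRing Pol

/-- The parameter `t`. -/
def t : K := algebraMap Pol K (MvPolynomial.X 0)

/-- The parameter `q`. -/
def q : K := algebraMap Pol K (MvPolynomial.X 1)

/-- `ord a ≥ M`: writing `a = A / B` with `A, B ∈ ℚ[t, q]`, the order of vanishing of `A` at
`t = 0` minus that of `B` is at least `M` (the order of vanishing of `0` is `⊤`). -/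
def OrdGE (M : ℕ) (a : K) : Prop :=
  ∃ A B : Pol, B ≠ 0 ∧ a = algebraMap Pol K A / algebraMap Pol K B ∧
    (M : ℕ∞) + emultiplicity (MvPolynomial.X 0) B ≤ emultiplicity (MvPolynomial.X 0) A

/-- `lim a_n = b` in `ℚ(t, q)`, that is, `ord (a_n - b) → +∞`. -/
def ScalarTendsTo (a : ℕ → K) (b : K) : Prop :=
  ∀ M : ℕ, ∀ᶠ n in atTop, OrdGE M (a n - b)

/-! ### Polynomials

Everything finite takes place inside `R = K[x₁, x₂, …]`. Indices start at `0`: the variable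
`X i` is `x_{i+1}`, and all operators indexed by `i : ℕ` below are the ones usually indexed by
`i + 1`. -/

/-- The polynomial ring `K[x₁, x₂, …]`; `X i` stands for `x_{i+1}`. -/
abbrev R : Type := MvPolynomial ℕ K

/-- The variable `x_{i+1}`. -/
def x (i : ℕ) : R := MvPolynomial.X i

/-- `𝒫ₖ⁺ = K[x₁, …, xₖ]`. -/
def P (k : ℕ) : Subalgebra K R := MvPolynomial.supported K (Set.Iio k)

/-- The substitution `x_j = 0` for all `j > k`. Its restriction `𝒫⁺_{k+1} → 𝒫⁺_k` is the
structure map of the inverse system (it kills `x_{k+1}` and fixes `x₁, …, xₖ`). -/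
def proj (k : ℕ) : R →ₐ[K] R := MvPolynomial.aeval fun j => if j < k then x j else 0

/-- The transposition of `x_{i+1}` and `x_{i+2}`. -/
def s (i : ℕ) : R →ₐ[K] R := MvPolynomial.rename (Equiv.swap i (i + 1))

theorem x_sub_ne_zero (i : ℕ) : x i - x (i + 1) ≠ 0 := by
  rw [sub_ne_zero]
  intro h
  have := MvPolynomial.X_injective h
  omega

theorem s_x (i j : ℕ) : s i (x j) = x (Equiv.swap i (i + 1) j) := by
  simp [s, x]

theorem s_s (i : ℕ) (f : R) : s i (s i f) = f := by
  simp only [s, MvPolynomial.rename_rename]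
  have : (⇑(Equiv.swap i (i + 1)) ∘ ⇑(Equiv.swap i (i + 1))) = id := by
    ext j; simp
  rw [this, MvPolynomial.rename_id, AlgHom.id_apply]

theorem dvd_sub_s (i : ℕ) (f : R) : x i - x (i + 1) ∣ f - s i f := by
  induction f using MvPolynomial.induction_on with
  | C a => simp [s]
  | add f g hf hg =>
    have : f + g - s i (f + g) = (f - s i f) + (g - s i g) := by rw [map_add]; ring
    rw [this]; exact dvd_add hf hg
  | mul_X f j hf =>
    change _ ∣ f * x j - s i (f * x j)
    have : f * x j - s i (f * x j) = (f - s i f) * x j + s i f * (x j - s i (x j)) := by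
      rw [map_mul]; ring
    rw [this]
    refine dvd_add (dvd_mul_of_dvd_left hf _) (dvd_mul_of_dvd_right ?_ _)
    rw [s_x]
    by_cases h1 : j = i
    · subst h1; simp
    · by_cases h2 : j = i + 1
      · subst h2
        simp only [Equiv.swap_apply_right]
        exact ⟨-1, by ring⟩
      · rw [Equiv.swap_apply_of_ne_of_ne h1 h2]; simp

/-- The divided difference `(f - s_i f) / (x_i - x_{i+1})`. -/
def dd (i : ℕ) (f : R) : R := (dvd_sub_s i f).choose

theorem dd_spec (i : ℕ) (f : R) : f - s i f = (x i - x (i + 1)) * dd i f :=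
  (dvd_sub_s i f).choose_spec

theorem dd_unique {i : ℕ} {f g : R} (h : f - s i f = (x i - x (i + 1)) * g) : dd i f = g :=
  mul_left_cancel₀ (x_sub_ne_zero i) ((dd_spec i f).symm.trans h)

/-- The Demazure–Lusztig operator
`T_i f = s_i f + (1 - t) x_i (f - s_i f) / (x_i - x_{i+1})`. -/
def T (i : ℕ) : R →ₗ[K] R where
  toFun f := s i f + (1 - t) • (x i * dd i f)
  map_add' f g := by
    have : dd i (f + g) = dd i f + dd i g := dd_unique (by
      rw [mul_add, ← dd_spec, ← dd_spec, map_add]; ring)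
    rw [this, map_add, mul_add, smul_add]; abel
  map_smul' c f := by
    have : dd i (c • f) = c • dd i f := dd_unique (by
      rw [mul_smul_comm, ← dd_spec, map_smul, smul_sub])
    rw [this, map_smul, RingHom.id_apply, smul_add, mul_smul_comm, smul_comm]

/-- The inverse of `T_i`, see `T_Tinv` and `Tinv_T`. -/
def Tinv (i : ℕ) : R →ₗ[K] R := t⁻¹ • (T i + (t - 1) • LinearMap.id)

theorem t_ne_zero : t ≠ 0 := by
  unfold t
  rw [Ne, FaithfulSMul.algebraMap_eq_zero_iff]
  exact MvPolynomial.X_ne_zero 0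

theorem T_T (i : ℕ) (f : R) : T i (T i f) = (1 - t) • T i f + t • f := by
  set g := dd i f with hg
  have hf : f = s i f + (x i - x (i + 1)) * g := by rw [hg, ← dd_spec]; ring
  have hD : s i (x i - x (i + 1)) = -(x i - x (i + 1)) := by
    rw [map_sub, s_x, s_x, Equiv.swap_apply_left, Equiv.swap_apply_right]; ring
  have hsg : s i g = g := by
    have h1 := congrArg (s i) (dd_spec i f)
    rw [map_sub, s_s, map_mul, hD, ← hg] at h1
    have h2 : (x i - x (i + 1)) * s i g = (x i - x (i + 1)) * g := by
      rw [hg, ← dd_spec, ← hg]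
      linear_combination h1
    exact mul_left_cancel₀ (x_sub_ne_zero i) h2
  have hT : T i f = s i f + (1 - t) • (x i * g) := rfl
  have hsT : s i (T i f) = f + (1 - t) • (x (i + 1) * g) := by
    rw [hT, map_add, s_s, map_smul, map_mul, hsg, s_x, Equiv.swap_apply_left]
  have hdT : dd i (T i f) = -(t • g) := dd_unique (by
    rw [hsT, hT]
    nth_rewrite 2 [hf]
    simp only [MvPolynomial.smul_eq_C_mul, map_sub, map_one]
    ring)
  have : T i (T i f) = s i (T i f) + (1 - t) • (x i * dd i (T i f)) := rfl
  rw [this, hdT, hsT, hT]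
  simp only [MvPolynomial.smul_eq_C_mul, map_sub, map_one]
  linear_combination (1 - MvPolynomial.C t) * hf

theorem T_Tinv (i : ℕ) (f : R) : T i (Tinv i f) = f := by
  simp only [Tinv, LinearMap.smul_apply, LinearMap.add_apply, LinearMap.id_apply, map_smul,
    map_add, T_T]
  rw [show (1 - t) • T i f + t • f + (t - 1) • T i f = t • f by
    rw [add_right_comm, ← add_smul]; simp, smul_smul,
    inv_mul_cancel₀ t_ne_zero, one_smul]

theorem Tinv_T (i : ℕ) (f : R) : Tinv i (T i f) = f := by
  simp only [Tinv, LinearMap.smul_apply, LinearMap.add_apply, LinearMap.id_apply, T_T]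
  rw [show (1 - t) • T i f + t • f + (t - 1) • T i f = t • f by
    rw [add_right_comm, ← add_smul]; simp, smul_smul,
    inv_mul_cancel₀ t_ne_zero, one_smul]

/-- `T_n⁻¹ ⋯ T_2⁻¹ T_1⁻¹` (usual numbering; `T_1⁻¹` is applied first). -/
def TinvChain : ℕ → (R →ₗ[K] R)
  | 0 => LinearMap.id
  | n + 1 => Tinv n ∘ₗ TinvChain n

/-- `pr₁`: the projection onto `x₁ R` that kills the monomials not divisible by `x₁`. -/
def pr1 : R →ₗ[K] R :=
  LinearMap.id - (MvPolynomial.aeval fun j => if j = 0 then (0 : R) else x j).toLinearMap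

/-- `f(x₁, …, xₖ) ↦ f(x₂, …, xₖ, q x₁)` on `𝒫ₖ⁺` (the other variables do not occur in `𝒫ₖ⁺`
and are left alone). -/
def cyc (k : ℕ) : R →ₐ[K] R :=
  MvPolynomial.aeval fun j =>
    if j + 1 < k then x (j + 1) else if j + 1 = k then q • x 0 else x j

/-- `ϖₖ f = pr₁ f(x₂, …, xₖ, q x₁)`. -/
def varpi (k : ℕ) : R →ₗ[K] R := pr1 ∘ₗ (cyc k).toLinearMap

/-- The deformed Cherednik operators on `𝒫ₖ⁺`: in the usual numbering
`Ỹ₁ = tᵏ ϖₖ T_{k-1}⁻¹ ⋯ T_1⁻¹` and `Ỹ_{i+1} = t⁻¹ T_i Ỹ_i T_i`. So `Ytilde k i` is `Ỹ_{i+1}⁽ᵏ⁾`,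
an operator on `𝒫ₖ⁺` for `i + 1 ≤ k`. -/
def Ytilde (k : ℕ) : ℕ → (R →ₗ[K] R)
  | 0 => t ^ k • (varpi k ∘ₗ TinvChain (k - 1))
  | i + 1 => t⁻¹ • (T i ∘ₗ Ytilde k i ∘ₗ T i)

/-! ### The inverse limit and the almost symmetric module -/

/-- The inverse limit `𝒫_∞⁺` of the rings `𝒫ₖ⁺`; the projection `Πₖ` is `F ↦ F k`. -/
def PInf : Submodule K (ℕ → R) where
  carrier := {F | ∀ k, F k ∈ P k ∧ proj k (F (k + 1)) = F k}
  add_mem' ha hb k := ⟨add_mem (ha k).1 (hb k).1, by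
    rw [Pi.add_apply, map_add, (ha k).2, (hb k).2, Pi.add_apply]⟩
  zero_mem' k := ⟨zero_mem _, by simp⟩
  smul_mem' c _ ha k := ⟨(P k).smul_mem (ha k).1 c, by
    rw [Pi.smul_apply, map_smul, (ha k).2, Pi.smul_apply]⟩

/-- The inverse limit of the `𝒫ₖ⁺` in the category of graded rings: the elements of bounded
degree of `PInf`. -/
def PInfGr : Submodule K (ℕ → R) where
  carrier := {F | F ∈ PInf ∧ ∃ d, ∀ k, (F k).totalDegree ≤ d}
  add_mem' := by
    rintro F G ⟨hF, d, hd⟩ ⟨hG, e, he⟩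
    exact ⟨add_mem hF hG, max d e, fun k =>
      (MvPolynomial.totalDegree_add _ _).trans (max_le_max (hd k) (he k))⟩
  zero_mem' := ⟨zero_mem _, 0, fun k => by simp⟩
  smul_mem' := by
    rintro c F ⟨hF, d, hd⟩
    exact ⟨PInf.smul_mem c hF, d, fun k => (MvPolynomial.totalDegree_smul_le c (F k)).trans (hd k)⟩

/-- The limit operator `𝒯_i`. The operators `T_i` on `𝒫_m⁺`, which exist once both variables
exchanged by `s_i` lie in `𝒫_m⁺`, are compatible with the inverse system and induce `𝒯_i` on the
inverse limit: `Πₖ 𝒯_i F` is the image in `𝒫ₖ⁺` of `T_i Π_m F` for `m` large enough. -/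
def limT (i : ℕ) : (ℕ → R) →ₗ[K] (ℕ → R) where
  toFun F k := proj k (T i (F (max k (i + 2))))
  map_add' F G := by ext1 k; simp
  map_smul' c F := by ext1 k; simp

/-- The limit operator `𝒳_i`: multiplication by `x_i` in the inverse limit. -/
def limX (i : ℕ) : (ℕ → R) →ₗ[K] (ℕ → R) where
  toFun F k := proj k (x i) * F k
  map_add' F G := by ext1 k; simp [mul_add]
  map_smul' c F := by ext1 k; simp

/-- `𝒫(n)⁺`: the elements fixed by `𝒯_i` for all `i > n` (usual numbering). Here `L` is the
inverse limit in use, `PInf` or `PInfGr`. -/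
def PSym (L : Submodule K (ℕ → R)) (n : ℕ) : Submodule K (ℕ → R) where
  carrier := {F | F ∈ L ∧ ∀ i, n ≤ i → limT i F = F}
  add_mem' ha hb := ⟨add_mem ha.1 hb.1, fun i hi => by rw [map_add, ha.2 i hi, hb.2 i hi]⟩
  zero_mem' := ⟨zero_mem _, fun i _ => map_zero _⟩
  smul_mem' c _ ha := ⟨L.smul_mem c ha.1, fun i hi => by rw [map_smul, ha.2 i hi]⟩

/-- The almost symmetric module `𝒫_as⁺ = ⋃ₙ 𝒫(n)⁺`. -/
def PAs (L : Submodule K (ℕ → R)) : Submodule K (ℕ → R) where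
  carrier := {F | ∃ n, F ∈ PSym L n}
  add_mem' := by
    rintro F G ⟨m, hF⟩ ⟨n, hG⟩
    exact ⟨max m n, add_mem hF.1 hG.1, fun i hi => by
      rw [map_add, hF.2 i ((le_max_left _ _).trans hi), hG.2 i ((le_max_right _ _).trans hi)]⟩
  zero_mem' := ⟨0, zero_mem _⟩
  smul_mem' := by
    rintro c F ⟨n, hF⟩
    exact ⟨n, (PSym L n).smul_mem c hF⟩

/-- `limₖ fₖ = F` for a sequence with `fₖ ∈ 𝒫ₖ⁺` for large `k`: there are `h` in the inverse limit,
finitely many almost symmetric `g_j`, and convergent sequences of scalars `a_{j,k} → b_j` with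
`fₖ = Πₖ h + ∑_j a_{j,k} Πₖ g_j`, and `F = h + ∑_j b_j g_j`.

The equation is required for all large `k` only, because `Ỹ_i⁽ᵏ⁾` exists only for `k ≥ i`. This
is no restriction: a single term `f_m ∈ 𝒫_m⁺` can be changed by any `g ∈ 𝒫_m⁺`, which is almost
symmetric, by means of the sequence of scalars that is `1` at `k = m` and `0` elsewhere. -/
def ConvergesTo (L : Submodule K (ℕ → R)) (f : ℕ → R) (F : ℕ → R) : Prop :=
  ∃ (N : ℕ) (h : ℕ → R) (g : Fin N → ℕ → R) (a : Fin N → ℕ → K) (b : Fin N → K),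
    h ∈ L ∧ (∀ j, g j ∈ PAs L) ∧ (∀ j, ScalarTendsTo (a j) (b j)) ∧
    (∀ᶠ k in atTop, f k = h k + ∑ j, a j k • g j k) ∧
    F = h + ∑ j, b j • g j

/-! ### The stable limit DAHA `ℋ⁺` -/

/-- The generators `T_i`, `X_i`, `Y_i` (`i : ℕ` stands for the index `i + 1`). -/
inductive Gen : Type
  | T (i : ℕ)
  | X (i : ℕ)
  | Y (i : ℕ)

/-- The free algebra on the generators. -/
abbrev Free : Type := FreeAlgebra K Gen

/-- The generator `T_i` in the free algebra. -/
def fT (i : ℕ) : Free := FreeAlgebra.ι K (Gen.T i)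

/-- The generator `X_i` in the free algebra. -/
def fX (i : ℕ) : Free := FreeAlgebra.ι K (Gen.X i)

/-- The generator `Y_i` in the free algebra. -/
def fY (i : ℕ) : Free := FreeAlgebra.ι K (Gen.Y i)

/-- A representative of `T_i⁻¹`: by the quadratic relation, `T_i` is invertible with inverse
`t⁻¹ (T_i + t - 1)`, see `HPlus.T_mul_Tinv` and `HPlus.Tinv_mul_T`. -/
def fTinv (i : ℕ) : Free := t⁻¹ • (fT i + algebraMap K Free (t - 1))

/-- The defining relations of `ℋ⁺`. -/
inductive Rel : Free → Free → Prop
  | T_comm (i j : ℕ) (h : i + 1 < j ∨ j + 1 < i) : Rel (fT i * fT j) (fT j * fT i)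
  | braid (i : ℕ) : Rel (fT i * fT (i + 1) * fT i) (fT (i + 1) * fT i * fT (i + 1))
  | quadratic (i : ℕ) : Rel ((fT i - 1) * (fT i + algebraMap K Free t)) 0
  | X_succ (i : ℕ) : Rel (t • (fTinv i * fX i * fTinv i)) (fX (i + 1))
  | T_X (i j : ℕ) (h₁ : j ≠ i) (h₂ : j ≠ i + 1) : Rel (fT i * fX j) (fX j * fT i)
  | X_comm (i j : ℕ) : Rel (fX i * fX j) (fX j * fX i)
  | Y_succ (i : ℕ) : Rel (t⁻¹ • (fT i * fY i * fT i)) (fY (i + 1))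
  | T_Y (i j : ℕ) (h₁ : j ≠ i) (h₂ : j ≠ i + 1) : Rel (fT i * fY j) (fY j * fT i)
  | Y_comm (i j : ℕ) : Rel (fY i * fY j) (fY j * fY i)
  | cross : Rel (fY 0 * fT 0 * fX 0) (fX 1 * fY 0 * fT 0)

/-- The `⁺`stable limit DAHA `ℋ⁺`. -/
def HPlus : Type := RingQuot Rel

instance HPlus.instRing : Ring HPlus := RingQuot.instRing Rel

instance HPlus.instAlgebra : Algebra K HPlus := RingQuot.instAlgebra Rel

namespace HPlus

/-- The canonical map from the free algebra. -/
def mk : Free →ₐ[K] HPlus := RingQuot.mkAlgHom K Rel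

/-- The generator `T_i` of `ℋ⁺`. -/
def T (i : ℕ) : HPlus := mk (fT i)

/-- The generator `X_i` of `ℋ⁺`. -/
def X (i : ℕ) : HPlus := mk (fX i)

/-- The generator `Y_i` of `ℋ⁺`. -/
def Y (i : ℕ) : HPlus := mk (fY i)

theorem quadratic (i : ℕ) : (T i - 1) * (T i + algebraMap K HPlus t) = 0 := by
  have h := RingQuot.mkAlgHom_rel K (Rel.quadratic i)
  rw [map_mul, map_sub, map_add, map_one, map_zero, AlgHom.commutes] at h
  exact h

theorem T_mul_Tinv (i : ℕ) : T i * mk (fTinv i) = 1 := by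
  have h := quadratic i
  have e : mk (fTinv i) = t⁻¹ • (T i + (algebraMap K HPlus t - 1)) := by
    simp only [fTinv, map_smul, map_add, AlgHom.commutes, map_sub, map_one, T]
  have h' : T i * (T i + (algebraMap K HPlus t - 1)) = algebraMap K HPlus t := by
    rw [← sub_eq_zero, ← h]
    simp only [mul_add, sub_mul, mul_sub, mul_one, one_mul]
    abel
  rw [e, mul_smul_comm, h', Algebra.algebraMap_eq_smul_one, smul_smul,
    inv_mul_cancel₀ t_ne_zero, one_smul]

theorem Tinv_mul_T (i : ℕ) : mk (fTinv i) * T i = 1 := by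
  have hc : mk (fTinv i) * T i = T i * mk (fTinv i) := by
    simp only [fTinv, map_smul, map_add, AlgHom.commutes, T, smul_mul_assoc, mul_smul_comm,
      add_mul, mul_add, Algebra.commutes]
  rw [hc, T_mul_Tinv]

end HPlus

/-- The representation `ρ` of `ℋ⁺` on `𝒫_as⁺` is the action by the limit operators: `T_i` and `X_i`
act as `𝒯_i` and `𝒳_i`, and `Y_i` acts as `𝒴_i F = limₖ Ỹ_i⁽ᵏ⁾ Πₖ F`. -/
def ActsByLimitOperators (L : Submodule K (ℕ → R))
    (ρ : HPlus →ₐ[K] Module.End K (PAs L)) : Prop :=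
  ∀ (i : ℕ) (F : PAs L),
    (ρ (HPlus.T i) F : ℕ → R) = limT i F ∧
    (ρ (HPlus.X i) F : ℕ → R) = limX i F ∧
    ConvergesTo L (fun k => Ytilde k i ((F : ℕ → R) k)) (ρ (HPlus.Y i) F : ℕ → R)

end StableDAHA

end

/-!
A vector of the almost symmetric module that is fixed by `T_i` for `i > n` is a sum `A + X_n B` in
which `A` is fixed by `T_i` for `i ≥ n`. Iterating this, every vector is `T_1 ⋯ T_n A + X_1 B` for
large `n`, with `A` fixed by `T_i` for `i > n`. On the first summand the deformed operator `Ỹ_1` of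
level `k` is `t^k` times a stable sequence, and on multiples of `X_1` it is stable itself. Hence the
limit `𝒴_1` exists, and `𝒴_{n+1}` kills all vectors fixed by `T_i` for `i > n`.

The relations that do not involve two of the `𝒴_i` hold at each large level `k`, and the `𝒴_i` all
commute as soon as `𝒴_1` and `𝒴_2` do. The commutators `c_n = [𝒴_n, 𝒴_{n+1}]` satisfy
`c_{n+1} = t⁻² T_n T_{n+1} c_n T_{n+1} T_n` with invertible `T_n`, so it suffices that on a given
space of vectors fixed by almost all `T_i` the operator `c_n` vanishes for large `n`. Since
`c_n T_n⁻¹ = -t⁻¹ T_n c_n`, the decomposition above, applied twice, leaves vectors that `𝒴_n` or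
`𝒴_{n+1}` kills and multiples of `X_n X_{n+1}`. The latter reduce to `c_1` on multiples of
`X_1 X_2`, where the deformed Cherednik operators agree with the usual ones, and these commute by
the braid relations.
-/

noncomputable section

namespace StableDAHA

section Braid

/-- A sequence of elements of a monoid that satisfies the relations of the braid group on
infinitely many strands. -/
structure IsBraid {M : Type*} [Monoid M] (g : ℕ → M) : Prop where
  commute_of_lt : ∀ {i j : ℕ}, i + 1 < j → Commute (g i) (g j)
  braid : ∀ i : ℕ, g i * g (i + 1) * g i = g (i + 1) * g i * g (i + 1)

variable {M : Type*} [Monoid M] {g : ℕ → M}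

/-- The product `g_{n-1} ⋯ g_1 g_0`. -/
def descProd (g : ℕ → M) : ℕ → M
  | 0 => 1
  | n + 1 => g n * descProd g n

/-- The product `g_0 g_1 ⋯ g_{n-1}`. -/
def ascProd (g : ℕ → M) : ℕ → M
  | 0 => 1
  | n + 1 => ascProd g n * g n

theorem descProd_zero (g : ℕ → M) : descProd g 0 = 1 := rfl

theorem descProd_succ (g : ℕ → M) (n : ℕ) : descProd g (n + 1) = g n * descProd g n := rfl

theorem ascProd_zero (g : ℕ → M) : ascProd g 0 = 1 := rfl

theorem ascProd_succ (g : ℕ → M) (n : ℕ) : ascProd g (n + 1) = ascProd g n * g n := rfl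

theorem commute_descProd {a : M} {n : ℕ} (h : ∀ i < n, Commute a (g i)) :
    Commute a (descProd g n) := by
  induction n with
  | zero => exact Commute.one_right a
  | succ n ih => exact (h n n.lt_succ_self).mul_right (ih fun i hi => h i (hi.trans n.lt_succ_self))

theorem IsBraid.commute (hg : IsBraid g) {i j : ℕ} (h : i + 1 < j ∨ j + 1 < i) :
    Commute (g i) (g j) :=
  h.elim hg.commute_of_lt fun h => (hg.commute_of_lt h).symm

theorem IsBraid.semiconjBy_mul_succ (hg : IsBraid g) (i : ℕ) :
    SemiconjBy (g i * g (i + 1)) (g i) (g (i + 1)) := by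
  rw [SemiconjBy, hg.braid, mul_assoc]

theorem IsBraid.semiconjBy_succ_mul (hg : IsBraid g) (i : ℕ) :
    SemiconjBy (g (i + 1) * g i) (g (i + 1)) (g i) := by
  rw [SemiconjBy, ← hg.braid, mul_assoc]

theorem IsBraid.commute_descProd (hg : IsBraid g) {n i : ℕ} (h : n < i) :
    Commute (g i) (descProd g n) :=
  StableDAHA.commute_descProd fun _ _ => hg.commute (by omega)

theorem IsBraid.semiconjBy_descProd (hg : IsBraid g) {n i : ℕ} (h : i + 2 ≤ n) :
    SemiconjBy (descProd g n) (g (i + 1)) (g i) := by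
  induction n, h using Nat.le_induction with
  | base =>
    rw [descProd_succ, descProd_succ, ← mul_assoc]
    exact (hg.semiconjBy_succ_mul i).mul_left (hg.commute_descProd i.lt_succ_self).symm.semiconjBy
  | succ n h ih => exact (hg.commute (by omega)).semiconjBy.mul_left ih

theorem IsBraid.semiconjBy_descProd_mul_descProd (hg : IsBraid g) (n : ℕ) :
    SemiconjBy (descProd g n * descProd g (n + 1)) (g 0) (g n) := by
  induction n with
  | zero =>
    rw [descProd_succ, descProd_zero, one_mul, mul_one]
    exact Commute.refl (g 0)
  | succ n ih =>
    have h : descProd g (n + 1) * descProd g (n + 2) =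
        g n * g (n + 1) * (descProd g n * descProd g (n + 1)) := by
      rw [descProd_succ g (n + 1), descProd_succ g n, mul_assoc, ← mul_assoc (descProd g n),
        ← (hg.commute_descProd n.lt_succ_self).eq]
      simp only [mul_assoc]
    rw [h]
    exact (hg.semiconjBy_mul_succ n).mul_left ih

end Braid

section Semigroup

variable {M : Type*} [Semigroup M] {a b z : M}

theorem commute_conj_conj (hab : a * b * a = b * a * b) (hz : Commute z b) :
    Commute a (b * (a * z * a) * b) :=
  calc a * (b * (a * z * a) * b) = (a * b * a) * z * a * b := by simp only [mul_assoc]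
    _ = b * a * (b * z) * a * b := by rw [hab]; simp only [mul_assoc]
    _ = b * a * z * (b * a * b) := by rw [← hz.eq]; simp only [mul_assoc]
    _ = b * (a * z * a) * b * a := by rw [← hab]; simp only [mul_assoc]

theorem conj_mul_conj_conj (hab : a * b * a = b * a * b) (hz : Commute z b) :
    a * z * a * (b * (a * z * a) * b) = a * b * (z * (a * z * a)) * (b * a) :=
  calc a * z * a * (b * (a * z * a) * b) = a * z * (a * b * a) * z * a * b := by
        simp only [mul_assoc]
    _ = a * (z * b) * a * (b * z) * a * b := by rw [hab]; simp only [mul_assoc]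
    _ = a * (b * z) * a * (z * b) * a * b := by rw [hz.eq]
    _ = a * b * z * a * z * (b * a * b) := by simp only [mul_assoc]
    _ = a * b * (z * (a * z * a)) * (b * a) := by rw [← hab]; simp only [mul_assoc]

theorem conj_conj_mul_conj (hab : a * b * a = b * a * b) (hz : Commute z b) :
    b * (a * z * a) * b * (a * z * a) = a * b * (a * z * a * z) * (b * a) :=
  calc b * (a * z * a) * b * (a * z * a) = b * a * z * (a * b * a) * z * a := by
        simp only [mul_assoc]
    _ = b * a * (z * b) * a * (b * z) * a := by rw [hab]; simp only [mul_assoc]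
    _ = b * a * (b * z) * a * (z * b) * a := by rw [hz.eq]
    _ = (b * a * b) * z * a * z * b * a := by simp only [mul_assoc]
    _ = a * b * (a * z * a * z) * (b * a) := by rw [← hab]; simp only [mul_assoc]

end Semigroup

section Hecke

theorem mul_lie_add_lie_mul {k A : Type*} [CommRing k] [Ring A] [Algebra k A] {τ : k} {a : A}
    (ha : a * a = (1 - τ) • a + τ • (1 : A)) (z : A) :
    a * ⁅z, a * z * a⁆ + ⁅z, a * z * a⁆ * a = (1 - τ) • ⁅z, a * z * a⁆ :=
  calc a * ⁅z, a * z * a⁆ + ⁅z, a * z * a⁆ * a = z * a * z * (a * a) - a * a * (z * a * z) := by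
        rw [Ring.lie_def]; noncomm_ring
    _ = (1 - τ) • ⁅z, a * z * a⁆ := by
        simp only [ha, Ring.lie_def, mul_add, add_mul, mul_smul_comm, smul_mul_assoc, mul_one,
          one_mul, add_sub_add_right_eq_sub, smul_sub, mul_assoc]

variable {F A : Type*} [Field F] [Ring A] [Algebra F A] {τ : F} {g : ℕ → A} {y : A}

/-- A sequence of elements of an `F`-algebra that satisfies the relations of the Hecke algebra of
the infinite symmetric group, with the quadratic relation `(g_i - 1) (g_i + τ) = 0`. -/
structure IsHecke (τ : F) (g : ℕ → A) : Prop extends IsBraid g where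
  ne_zero : τ ≠ 0
  mul_self : ∀ i : ℕ, g i * g i = (1 - τ) • g i + τ • (1 : A)

/-- The inverse of the element `g_i` of a sequence satisfying the Hecke relations. -/
def heckeInv (τ : F) (g : ℕ → A) (i : ℕ) : A := τ⁻¹ • (g i + (τ - 1) • (1 : A))

theorem semiconjBy_heckeInv {a : A} {i j : ℕ} (h : SemiconjBy a (g i) (g j)) :
    SemiconjBy a (heckeInv τ g i) (heckeInv τ g j) := by
  rw [SemiconjBy, heckeInv, heckeInv, mul_smul_comm, mul_add, h.eq, mul_smul_comm, smul_mul_assoc,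
    add_mul, smul_mul_assoc, mul_one, one_mul]

/-- The elements `y_0 = y`, `y_{i+1} = τ⁻¹ g_i y_i g_i`, of Jucys–Murphy type: the operators `Y_i`
of `ℋ⁺` are obtained in this way from the first of them. -/
def jucys (τ : F) (g : ℕ → A) (y : A) : ℕ → A
  | 0 => y
  | i + 1 => τ⁻¹ • (g i * jucys τ g y i * g i)

theorem jucys_zero (τ : F) (g : ℕ → A) (y : A) : jucys τ g y 0 = y := rfl

theorem jucys_succ (τ : F) (g : ℕ → A) (y : A) (i : ℕ) :
    jucys τ g y (i + 1) = τ⁻¹ • (g i * jucys τ g y i * g i) := rfl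

theorem exists_jucys_eq_mul_ascProd (τ : F) (g : ℕ → A) (y : A) (n : ℕ) :
    ∃ d, jucys τ g y n = d * y * ascProd g n := by
  induction n with
  | zero => exact ⟨1, by rw [jucys_zero, ascProd_zero, one_mul, mul_one]⟩
  | succ n ih =>
    obtain ⟨d, hd⟩ := ih
    refine ⟨τ⁻¹ • (g n * d), ?_⟩
    rw [jucys_succ, hd, ascProd_succ]
    simp only [smul_mul_assoc, mul_assoc]

namespace IsHecke

theorem sub_one_mul_add_algebraMap (hg : IsHecke τ g) (i : ℕ) :
    (g i - 1) * (g i + algebraMap F A τ) = 0 := by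
  rw [Algebra.algebraMap_eq_smul_one, mul_add, sub_mul, hg.mul_self, mul_smul_comm, mul_one,
    one_mul]
  module

theorem mul_heckeInv (hg : IsHecke τ g) (i : ℕ) : g i * heckeInv τ g i = 1 := by
  have h : g i * (g i + (τ - 1) • (1 : A)) = τ • (1 : A) := by
    rw [mul_add, hg.mul_self, mul_smul_comm, mul_one]
    module
  rw [heckeInv, mul_smul_comm, h, inv_smul_smul₀ hg.ne_zero]

theorem heckeInv_mul (hg : IsHecke τ g) (i : ℕ) : heckeInv τ g i * g i = 1 :=
  (semiconjBy_heckeInv (Commute.refl (g i)).semiconjBy).eq.symm.trans (hg.mul_heckeInv i)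

theorem mul_heckeInv_cancel_left (hg : IsHecke τ g) (i : ℕ) (a : A) :
    g i * (heckeInv τ g i * a) = a := by
  rw [← mul_assoc, hg.mul_heckeInv, one_mul]

theorem heckeInv_mul_cancel_left (hg : IsHecke τ g) (i : ℕ) (a : A) :
    heckeInv τ g i * (g i * a) = a := by
  rw [← mul_assoc, hg.heckeInv_mul, one_mul]

theorem semiconjBy_of_heckeInv (hg : IsHecke τ g) {a : A} {i j : ℕ}
    (h : SemiconjBy a (heckeInv τ g i) (heckeInv τ g j)) : SemiconjBy a (g i) (g j) :=
  calc a * g i = g j * (heckeInv τ g j * a) * g i := by rw [hg.mul_heckeInv_cancel_left]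
    _ = g j * a := by rw [← h.eq, mul_assoc, mul_assoc, hg.heckeInv_mul, mul_one]

theorem isBraid_heckeInv (hg : IsHecke τ g) : IsBraid (heckeInv τ g) where
  commute_of_lt h := semiconjBy_heckeInv (semiconjBy_heckeInv (hg.commute_of_lt h).symm).symm
  braid i := by
    refine left_inv_eq_right_inv (a := g i * g (i + 1) * g i) ?_ ?_
    · simp only [mul_assoc, hg.heckeInv_mul_cancel_left, hg.heckeInv_mul]
    · rw [hg.braid]
      simp only [mul_assoc, hg.mul_heckeInv_cancel_left, hg.mul_heckeInv]

theorem semiconjBy_descProd_heckeInv (hg : IsHecke τ g) {n i : ℕ} (h : i + 2 ≤ n) :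
    SemiconjBy (descProd (heckeInv τ g) n) (g (i + 1)) (g i) :=
  hg.semiconjBy_of_heckeInv (hg.isBraid_heckeInv.semiconjBy_descProd h)

theorem semiconjBy_descProd_heckeInv_mul_descProd_heckeInv (hg : IsHecke τ g) (n : ℕ) :
    SemiconjBy (descProd (heckeInv τ g) n * descProd (heckeInv τ g) (n + 1)) (g 0) (g n) :=
  hg.semiconjBy_of_heckeInv (hg.isBraid_heckeInv.semiconjBy_descProd_mul_descProd n)

theorem commute_jucys_of_lt (hg : IsHecke τ g) (hy : ∀ i, 0 < i → Commute (g i) y) {i j : ℕ}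
    (h : j < i) : Commute (g i) (jucys τ g y j) := by
  induction j with
  | zero => exact hy i h
  | succ j ih =>
    have hij : Commute (g i) (g j) := hg.commute (by omega)
    exact ((hij.mul_right (ih (by omega))).mul_right hij).smul_right τ⁻¹

theorem commute_jucys (hg : IsHecke τ g) (hy : ∀ i, 0 < i → Commute (g i) y) {i j : ℕ}
    (h₁ : j ≠ i) (h₂ : j ≠ i + 1) : Commute (g i) (jucys τ g y j) := by
  rcases Nat.lt_or_ge j i with h | h
  · exact hg.commute_jucys_of_lt hy h
  replace h : i + 2 ≤ j := by omega
  clear h₁ h₂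
  induction j, h using Nat.le_induction with
  | base =>
    have hz := (hg.commute_jucys_of_lt hy i.lt_succ_self).symm
    rw [jucys_succ, jucys_succ, mul_smul_comm, smul_mul_assoc]
    exact ((commute_conj_conj (hg.braid i) hz).smul_right τ⁻¹).smul_right τ⁻¹
  | succ j h ih =>
    have hij : Commute (g i) (g j) := hg.commute (by omega)
    exact ((hij.mul_right ih).mul_right hij).smul_right τ⁻¹

theorem lie_jucys_succ (hg : IsHecke τ g) (hy : ∀ i, 0 < i → Commute (g i) y) (i : ℕ) :
    ⁅jucys τ g y (i + 1), jucys τ g y (i + 2)⁆ = (τ⁻¹ * τ⁻¹) •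
      (g i * g (i + 1) * ⁅jucys τ g y i, jucys τ g y (i + 1)⁆ * (g (i + 1) * g i)) := by
  have hz := (hg.commute_jucys_of_lt hy i.lt_succ_self).symm
  have h₁ := conj_mul_conj_conj (hg.braid i) hz
  have h₂ := conj_conj_mul_conj (hg.braid i) hz
  rw [Ring.lie_def, Ring.lie_def, jucys_succ τ g y (i + 1), jucys_succ τ g y i]
  simp only [mul_smul_comm, smul_mul_assoc, mul_sub, sub_mul, smul_sub, h₁, h₂, smul_smul,
    mul_assoc τ⁻¹]

theorem lie_jucys_mul_heckeInv (hg : IsHecke τ g) (y : A) (i : ℕ) :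
    ⁅jucys τ g y i, jucys τ g y (i + 1)⁆ * heckeInv τ g i =
      -(τ⁻¹ • (g i * ⁅jucys τ g y i, jucys τ g y (i + 1)⁆)) := by
  have h : ∀ c : A, g i * c + c * g i = (1 - τ) • c →
      c * heckeInv τ g i = -(τ⁻¹ • (g i * c)) := fun c hc => by
    rw [heckeInv, mul_smul_comm, mul_add, eq_sub_of_add_eq' hc, mul_smul_comm, mul_one]
    module
  refine h _ ?_
  have hlie : ⁅jucys τ g y i, jucys τ g y (i + 1)⁆ =
      τ⁻¹ • ⁅jucys τ g y i, g i * jucys τ g y i * g i⁆ := by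
    rw [jucys_succ, Ring.lie_def, Ring.lie_def, mul_smul_comm, smul_mul_assoc, smul_sub]
  rw [hlie, mul_smul_comm, smul_mul_assoc, ← smul_add,
    mul_lie_add_lie_mul (hg.mul_self i), smul_comm]

theorem jucys_commute (hg : IsHecke τ g) (hy : ∀ i, 0 < i → Commute (g i) y)
    (h₀ : Commute y (jucys τ g y 1)) (i j : ℕ) : Commute (jucys τ g y i) (jucys τ g y j) := by
  have hz : ∀ j, Commute y (jucys τ g y j) := by
    intro j
    induction j with
    | zero => exact Commute.refl y
    | succ j ih =>
      rcases j.eq_zero_or_pos with rfl | hj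
      · exact h₀
      · exact (((hy j hj).symm.mul_right ih).mul_right (hy j hj).symm).smul_right τ⁻¹
  have hlt : ∀ i j, i < j → Commute (jucys τ g y i) (jucys τ g y j) := by
    intro i
    induction i with
    | zero => exact fun j _ => hz j
    | succ i ih =>
      intro j hj
      have hij : Commute (g i) (jucys τ g y j) := hg.commute_jucys hy (by omega) (by omega)
      exact ((hij.mul_left (ih j (by omega))).mul_left hij).smul_left τ⁻¹
  rcases lt_trichotomy i j with h | rfl | h
  · exact hlt i j h
  · exact Commute.refl _
  · exact (hlt j i h).symm

end IsHecke

end Hecke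

section AlmostSymmetric

variable {F V : Type*} [Field F] [AddCommGroup V] [Module F V] {τ : F}
  {g X : ℕ → Module.End F V} {y : Module.End F V}

/-- The vector `v` is fixed by the operators `g i` with `n ≤ i`. In the almost symmetric module
this is membership in `𝒫(n)⁺`. -/
def IsFixed (g : ℕ → Module.End F V) (n : ℕ) (v : V) : Prop := ∀ i, n ≤ i → g i v = v

theorem IsFixed.mono {n m : ℕ} {v : V} (hv : IsFixed g n v) (h : n ≤ m) : IsFixed g m v :=
  fun i hi => hv i (h.trans hi)

theorem IsFixed.map {n : ℕ} {v : V} (hv : IsFixed g n v) {f : Module.End F V}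
    (hf : ∀ i, n ≤ i → Commute (g i) f) : IsFixed g n (f v) := fun i hi => by
  rw [← Module.End.mul_apply, (hf i hi).eq, Module.End.mul_apply, hv i hi]

namespace IsHecke

theorem apply_heckeInv (hg : IsHecke τ g) (i : ℕ) (v : V) : g i (heckeInv τ g i v) = v :=
  LinearMap.congr_fun (hg.mul_heckeInv i) v

theorem heckeInv_apply (hg : IsHecke τ g) (i : ℕ) (v : V) : heckeInv τ g i (g i v) = v :=
  LinearMap.congr_fun (hg.heckeInv_mul i) v

theorem injective (hg : IsHecke τ g) (i : ℕ) : Function.Injective (g i) :=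
  Function.LeftInverse.injective (hg.heckeInv_apply i)

theorem isFixed_heckeInv (hg : IsHecke τ g) {n i : ℕ} {v : V} (hv : IsFixed g n v)
    (hi : i + 2 ≤ n) : IsFixed g n (heckeInv τ g i v) :=
  hv.map fun _ _ => semiconjBy_heckeInv (hg.commute (by omega))

end IsHecke

/-- Operators `g i` and `X i` on a vector space that satisfy the relations of the `T_i` and `X_i`
of `ℋ⁺`, such that every vector is fixed by almost all `g i`, and a vector fixed by `g i` for
`n < i` is the sum of one fixed for `n ≤ i` and of one divisible by `X n`. -/
structure IsAlmostSymmetric (τ : F) (g X : ℕ → Module.End F V) : Prop where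
  hecke : IsHecke τ g
  mul_X_mul : ∀ i, g i * X (i + 1) * g i = τ • X i
  commute_X : ∀ {i j}, j ≠ i → j ≠ i + 1 → Commute (g i) (X j)
  exists_isFixed : ∀ v, ∃ n, IsFixed g n v
  exists_eq_add : ∀ {n v}, IsFixed g (n + 1) v →
    ∃ a b, IsFixed g n a ∧ IsFixed g (n + 1) b ∧ v = a + X n b

namespace IsAlmostSymmetric

theorem apply_X_succ (h : IsAlmostSymmetric τ g X) (n : ℕ) (v : V) :
    g n (X (n + 1) v) = τ • X n (heckeInv τ g n v) := by
  have e := LinearMap.congr_fun (h.mul_X_mul n) (heckeInv τ g n v)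
  rwa [Module.End.mul_apply, Module.End.mul_apply, h.hecke.apply_heckeInv] at e

theorem X_succ_apply (h : IsAlmostSymmetric τ g X) (n : ℕ) (v : V) :
    X (n + 1) v = τ • heckeInv τ g n (X n (heckeInv τ g n v)) := by
  rw [← map_smul, ← h.apply_X_succ, h.hecke.heckeInv_apply]

theorem mul_X_mul_X_mul (h : IsAlmostSymmetric τ g X) (i : ℕ) :
    g (i + 1) * g i * (X (i + 1) * X (i + 2)) * (g i * g (i + 1)) =
      (τ * τ) • (X i * X (i + 1)) :=
  calc g (i + 1) * g i * (X (i + 1) * X (i + 2)) * (g i * g (i + 1))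
    _ = g (i + 1) * g i * X (i + 1) * (X (i + 2) * g i) * g (i + 1) := by simp only [mul_assoc]
    _ = g (i + 1) * (g i * X (i + 1) * g i) * X (i + 2) * g (i + 1) := by
        rw [← (h.commute_X (i := i) (j := i + 2) (by omega) (by omega)).eq]
        simp only [mul_assoc]
    _ = τ • (g (i + 1) * X i * X (i + 2) * g (i + 1)) := by
        rw [h.mul_X_mul, mul_smul_comm, smul_mul_assoc, smul_mul_assoc]
    _ = τ • (X i * (g (i + 1) * X (i + 2) * g (i + 1))) := by
        rw [(h.commute_X (i := i + 1) (j := i) (by omega) (by omega)).eq]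
        simp only [mul_assoc]
    _ = (τ * τ) • (X i * X (i + 1)) := by rw [h.mul_X_mul, mul_smul_comm, smul_smul]

theorem exists_ascProd_X_eq (h : IsAlmostSymmetric τ g X) (n : ℕ) (v : V) :
    ∃ w, ascProd g n (X n v) = X 0 w := by
  induction n generalizing v with
  | zero => exact ⟨v, rfl⟩
  | succ n ih =>
    obtain ⟨w, hw⟩ := ih (τ • heckeInv τ g n v)
    exact ⟨w, by rw [← hw, ascProd_succ, Module.End.mul_apply, h.apply_X_succ,
      map_smul (X n)]⟩

theorem exists_eq_ascProd_add (h : IsAlmostSymmetric τ g X) {n : ℕ} {v : V}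
    (hv : IsFixed g n v) : ∃ a b, IsFixed g n a ∧ v = ascProd g n a + X 0 b := by
  have hasc : ∀ m ≤ n, ∃ w, IsFixed g (n + 1) w ∧ v = ascProd g m w := by
    intro m
    induction m with
    | zero => exact fun _ => ⟨v, hv.mono n.le_succ, rfl⟩
    | succ m ih =>
      intro hm
      obtain ⟨w, hw, rfl⟩ := ih (by omega)
      refine ⟨heckeInv τ g m w, h.hecke.isFixed_heckeInv hw (by omega), ?_⟩
      rw [ascProd_succ, Module.End.mul_apply, h.hecke.apply_heckeInv]
  obtain ⟨w, hw, rfl⟩ := hasc n le_rfl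
  obtain ⟨a, b, ha, -, rfl⟩ := h.exists_eq_add hw
  obtain ⟨c, hc⟩ := h.exists_ascProd_X_eq n b
  exact ⟨a, c, ha, by rw [map_add, hc]⟩

theorem lie_jucys_X_X (h : IsAlmostSymmetric τ g X) (hy : ∀ i, 0 < i → Commute (g i) y)
    (h₀ : ∀ v, ⁅y, jucys τ g y 1⁆ (X 0 (X 1 v)) = 0) (i : ℕ) (v : V) :
    ⁅jucys τ g y i, jucys τ g y (i + 1)⁆ (X i (X (i + 1) v)) = 0 := by
  induction i generalizing v with
  | zero => exact h₀ v
  | succ i ih =>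
    obtain ⟨w, rfl⟩ : ∃ w, v = (g i * g (i + 1)) w :=
      ⟨_, by rw [Module.End.mul_apply, h.hecke.apply_heckeInv (i + 1), h.hecke.apply_heckeInv i v]⟩
    have e : (g (i + 1) * g i) (X (i + 1) (X (i + 2) ((g i * g (i + 1)) w))) =
        (τ * τ) • X i (X (i + 1) w) := LinearMap.congr_fun (h.mul_X_mul_X_mul i) w
    rw [h.hecke.lie_jucys_succ hy, LinearMap.smul_apply, Module.End.mul_apply, e, map_smul,
      Module.End.mul_apply, ih, map_zero, smul_zero, smul_zero]

theorem lie_jucys_of_isFixed_succ (h : IsAlmostSymmetric τ g X)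
    (hy : ∀ i, 0 < i → Commute (g i) y)
    (hk : ∀ n v, IsFixed g n v → jucys τ g y n v = 0) {n : ℕ} {v : V}
    (hv : IsFixed g (n + 1) v) : ⁅jucys τ g y n, jucys τ g y (n + 1)⁆ v = 0 := by
  rw [Ring.lie_def, LinearMap.sub_apply, Module.End.mul_apply, Module.End.mul_apply, hk _ _ hv,
    hk (n + 1) _ (hv.map fun i hi => h.hecke.commute_jucys_of_lt hy hi), map_zero, sub_zero]

theorem lie_jucys_heckeInv (h : IsAlmostSymmetric τ g X) {n : ℕ} {v : V}
    (hv : ⁅jucys τ g y n, jucys τ g y (n + 1)⁆ v = 0) :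
    ⁅jucys τ g y n, jucys τ g y (n + 1)⁆ (heckeInv τ g n v) = 0 := by
  rw [← Module.End.mul_apply, h.hecke.lie_jucys_mul_heckeInv, LinearMap.neg_apply,
    LinearMap.smul_apply, Module.End.mul_apply, hv, map_zero, smul_zero, neg_zero]

theorem lie_jucys_of_isFixed (h : IsAlmostSymmetric τ g X) (hy : ∀ i, 0 < i → Commute (g i) y)
    (h₀ : ∀ v, ⁅y, jucys τ g y 1⁆ (X 0 (X 1 v)) = 0)
    (hk : ∀ n v, IsFixed g n v → jucys τ g y n v = 0) {n : ℕ} {v : V}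
    (hv : IsFixed g (n + 2) v) : ⁅jucys τ g y n, jucys τ g y (n + 1)⁆ v = 0 := by
  obtain ⟨a, b, ha, hb, rfl⟩ := h.exists_eq_add hv
  obtain ⟨c, d, hc, -, hcd⟩ := h.exists_eq_add (h.hecke.isFixed_heckeInv hb le_rfl)
  rw [map_add, h.lie_jucys_of_isFixed_succ hy hk ha, zero_add, h.X_succ_apply, map_smul,
    h.lie_jucys_heckeInv, smul_zero]
  rw [hcd, map_add, map_add, h.lie_jucys_X_X hy h₀, add_zero]
  exact h.lie_jucys_of_isFixed_succ hy hk (hc.map fun i hi => h.commute_X (by omega) (by omega))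

theorem jucys_commute_one (h : IsAlmostSymmetric τ g X) (hy : ∀ i, 0 < i → Commute (g i) y)
    (h₀ : ∀ v, ⁅y, jucys τ g y 1⁆ (X 0 (X 1 v)) = 0)
    (hk : ∀ n v, IsFixed g n v → jucys τ g y n v = 0) : Commute y (jucys τ g y 1) := by
  rw [commute_iff_lie_eq]
  ext v
  obtain ⟨n, hv⟩ := h.exists_isFixed v
  have hlie : ∀ m ≤ n, ∀ w, IsFixed g (n + 2) w →
      ⁅jucys τ g y m, jucys τ g y (m + 1)⁆ w = 0 := by
    intro m hm
    induction hm using Nat.decreasingInduction with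
    | self => exact fun w hw => h.lie_jucys_of_isFixed hy h₀ hk hw
    | of_succ m hm ih =>
      intro w hw
      have hsucc := ih _ (h.hecke.isFixed_heckeInv (i := m)
        (h.hecke.isFixed_heckeInv (i := m + 1) hw (by omega)) (by omega))
      have hτ : τ⁻¹ * τ⁻¹ ≠ 0 :=
        mul_ne_zero (inv_ne_zero h.hecke.ne_zero) (inv_ne_zero h.hecke.ne_zero)
      simp only [h.hecke.lie_jucys_succ hy, LinearMap.smul_apply, Module.End.mul_apply,
        h.hecke.apply_heckeInv, smul_eq_zero, hτ, false_or] at hsucc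
      rwa [map_eq_zero_iff _ (h.hecke.injective m),
        map_eq_zero_iff _ (h.hecke.injective (m + 1))] at hsucc
  exact hlie 0 n.zero_le v (hv.mono (by omega))

end IsAlmostSymmetric

end AlmostSymmetric

section Substitutions

theorem x_ne_zero (i : ℕ) : x i ≠ 0 := MvPolynomial.X_ne_zero i

theorem algHom_comp_apply_eq {φ ψ φ' ψ' : R →ₐ[K] R}
    (h : ∀ j, φ (ψ (x j)) = φ' (ψ' (x j))) (f : R) : φ (ψ f) = φ' (ψ' f) :=
  DFunLike.congr_fun (MvPolynomial.algHom_ext (f := φ.comp ψ) (g := φ'.comp ψ') h) f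

theorem dvd_algHom_sub {a : R} {φ ψ : R →ₐ[K] R} (h : ∀ j, a ∣ φ (x j) - ψ (x j)) (f : R) :
    a ∣ φ f - ψ f := by
  let π := Ideal.Quotient.mkₐ K (Ideal.span {a})
  have hπ : π.comp φ = π.comp ψ := MvPolynomial.algHom_ext fun j =>
    Ideal.Quotient.eq.2 (Ideal.mem_span_singleton.2 (h j))
  exact Ideal.mem_span_singleton.1 (Ideal.Quotient.eq.1 (DFunLike.congr_fun hπ f))

theorem s_x_left (i : ℕ) : s i (x i) = x (i + 1) := by rw [s_x, Equiv.swap_apply_left]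

theorem s_x_right (i : ℕ) : s i (x (i + 1)) = x i := by rw [s_x, Equiv.swap_apply_right]

theorem s_x_of_ne {i j : ℕ} (h₁ : j ≠ i) (h₂ : j ≠ i + 1) : s i (x j) = x j := by
  rw [s_x, Equiv.swap_apply_of_ne_of_ne h₁ h₂]

theorem s_x_eq_ite (i j : ℕ) :
    s i (x j) = if j = i then x (i + 1) else if j = i + 1 then x i else x j := by
  rw [s_x, Equiv.swap_apply_def]
  split_ifs <;> rfl

theorem s_comm {i j : ℕ} (h : i + 1 < j) (f : R) : s i (s j f) = s j (s i f) :=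
  algHom_comp_apply_eq (fun l => by
    simp only [s_x_eq_ite]
    split_ifs <;> simp [s_x_eq_ite] <;> grind) f

theorem proj_x (k j : ℕ) : proj k (x j) = if j < k then x j else 0 := MvPolynomial.aeval_X _ j

theorem proj_proj {k m : ℕ} (h : k ≤ m) (f : R) : proj k (proj m f) = proj k f :=
  algHom_comp_apply_eq (ψ' := AlgHom.id K R) (fun j => by
    simp only [proj_x, AlgHom.id_apply]
    split_ifs <;> simp [proj_x] <;> omega) f

theorem proj_mem_P (k : ℕ) (f : R) : proj k f ∈ P k := by
  have hf : proj k f ∈ (proj k).range := ⟨f, rfl⟩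
  rw [proj, ← Algebra.adjoin_range_eq_range_aeval] at hf
  refine Algebra.adjoin_le ?_ hf
  rintro _ ⟨j, rfl⟩
  dsimp only
  split_ifs with h
  · exact MvPolynomial.X_mem_supported.2 h
  · exact zero_mem _

theorem mem_P_iff {k : ℕ} {f : R} : f ∈ P k ↔ proj k f = f := by
  refine ⟨fun hf => ?_, fun hf => hf ▸ proj_mem_P k f⟩
  rw [P, MvPolynomial.supported_eq_adjoin_X] at hf
  refine AlgHom.adjoin_le_equalizer (proj k) (AlgHom.id K R) ?_ hf
  rintro _ ⟨j, hj, rfl⟩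
  exact (proj_x k j).trans (if_pos hj)

theorem proj_s {k i : ℕ} (h : i + 2 ≤ k) (f : R) : proj k (s i f) = s i (proj k f) :=
  algHom_comp_apply_eq (fun j => by
    simp only [s_x_eq_ite, proj_x]
    split_ifs <;> simp [proj_x, s_x_eq_ite] <;> grind) f

/-- The substitution `x_n = 0`. -/
def kill (n : ℕ) : R →ₐ[K] R := MvPolynomial.aeval fun j => if j = n then (0 : R) else x j

theorem kill_x (n j : ℕ) : kill n (x j) = if j = n then 0 else x j := MvPolynomial.aeval_X _ j

theorem x_dvd_sub_kill (n : ℕ) (f : R) : x n ∣ f - kill n f :=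
  dvd_algHom_sub (φ := AlgHom.id K R) (fun j => by
    rw [AlgHom.id_apply, kill_x]
    split_ifs with h <;> simp [h]) f

theorem x_dvd_iff_kill_eq_zero {n : ℕ} {f : R} : x n ∣ f ↔ kill n f = 0 := by
  constructor
  · rintro ⟨g, rfl⟩
    rw [map_mul, kill_x, if_pos rfl, zero_mul]
  · intro h
    simpa only [h, sub_zero] using x_dvd_sub_kill n f

theorem kill_proj (n k : ℕ) (f : R) : kill n (proj k f) = proj k (kill n f) :=
  algHom_comp_apply_eq (fun j => by
    simp only [proj_x, kill_x]
    split_ifs <;> simp [kill_x, proj_x] <;> grind) f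

theorem kill_s {n i : ℕ} (h : n < i) (f : R) : kill n (s i f) = s i (kill n f) :=
  algHom_comp_apply_eq (fun j => by
    simp only [s_x_eq_ite, kill_x]
    split_ifs <;> simp [kill_x, s_x_eq_ite] <;> grind) f

theorem cyc_x (k j : ℕ) : cyc k (x j) =
    if j + 1 < k then x (j + 1) else if j + 1 = k then q • x 0 else x j := MvPolynomial.aeval_X _ j

theorem cyc_x_of_lt {k j : ℕ} (h : j + 1 < k) : cyc k (x j) = x (j + 1) := by
  rw [cyc_x, if_pos h]

theorem cyc_x_last (j : ℕ) : cyc (j + 1) (x j) = q • x 0 := by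
  rw [cyc_x, if_neg (by omega), if_pos rfl]

theorem cyc_x_of_le {k j : ℕ} (h : k ≤ j) : cyc k (x j) = x j := by
  rw [cyc_x, if_neg (by omega), if_neg (by omega)]

theorem cyc_s {k i : ℕ} (h : i + 2 < k) (f : R) : cyc k (s i f) = s (i + 1) (cyc k f) :=
  algHom_comp_apply_eq (fun j => by
    simp only [s_x_eq_ite, cyc_x]
    split_ifs <;> simp [cyc_x, s_x_eq_ite] <;> grind) f

theorem cyc_cyc_s (m : ℕ) (f : R) :
    cyc (m + 2) (cyc (m + 2) (s m f)) = s 0 (cyc (m + 2) (cyc (m + 2) f)) := by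
  have h : ((cyc (m + 2)).comp (cyc (m + 2))).comp (s m) =
      (s 0).comp ((cyc (m + 2)).comp (cyc (m + 2))) := MvPolynomial.algHom_ext fun j => by
    change cyc (m + 2) (cyc (m + 2) (s m (x j))) = s 0 (cyc (m + 2) (cyc (m + 2) (x j)))
    have hlast : cyc (m + 2) (x (m + 1)) = q • x 0 := cyc_x_last (m + 1)
    have hzero : cyc (m + 2) (x 0) = x 1 := cyc_x_of_lt (by omega)
    have hm : cyc (m + 2) (x m) = x (m + 1) := cyc_x_of_lt (by omega)
    obtain hj | rfl | rfl | hj : j < m ∨ j = m ∨ j = m + 1 ∨ m + 2 ≤ j := by omega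
    · rw [s_x_of_ne (by omega) (by omega), cyc_x_of_lt (by omega), cyc_x_of_lt (by omega),
        s_x_of_ne (by omega) (by omega)]
    · rw [s_x_left, hlast, hm, hlast, map_smul, map_smul, hzero, s_x_left]
    · rw [s_x_right, hm, hlast, map_smul, map_smul, hzero, s_x_right 0]
    · rw [s_x_of_ne (by omega) (by omega), cyc_x_of_le hj, cyc_x_of_le hj,
        s_x_of_ne (by omega) (by omega)]
  exact DFunLike.congr_fun h f

theorem proj_cyc (k : ℕ) (f : R) : proj (k + 1) (cyc (k + 1) f) = cyc (k + 1) (proj (k + 1) f) :=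
  algHom_comp_apply_eq (fun j => by
    simp only [proj_x, cyc_x]
    split_ifs <;> simp [cyc_x, proj_x] <;> grind) f

theorem proj_cyc_s (k : ℕ) (f : R) :
    proj (k + 1) (cyc (k + 2) (s k f)) = cyc (k + 1) (proj (k + 1) f) := by
  have h : (proj (k + 1)).comp ((cyc (k + 2)).comp (s k)) =
      (cyc (k + 1)).comp (proj (k + 1)) := MvPolynomial.algHom_ext fun j => by
    change proj (k + 1) (cyc (k + 2) (s k (x j))) = cyc (k + 1) (proj (k + 1) (x j))
    have hk : cyc (k + 2) (x k) = x (k + 1) := cyc_x_of_lt (by omega)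
    have hlast : cyc (k + 2) (x (k + 1)) = q • x 0 := cyc_x_last (k + 1)
    have hzero : proj (k + 1) (x 0) = x 0 := by rw [proj_x, if_pos (by omega)]
    obtain hj | rfl | rfl | hj : j < k ∨ j = k ∨ j = k + 1 ∨ k + 2 ≤ j := by omega
    · rw [s_x_of_ne (by omega) (by omega), cyc_x_of_lt (by omega), proj_x, proj_x,
        if_pos (by omega), if_pos (by omega), cyc_x_of_lt (by omega)]
    · rw [s_x_left, hlast, map_smul, hzero, proj_x, if_pos (by omega), cyc_x_last]
    · rw [s_x_right, hk, proj_x, if_neg (by omega), map_zero]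
    · rw [s_x_of_ne (by omega) (by omega), cyc_x_of_le hj, proj_x, if_neg (by omega), map_zero]
  exact DFunLike.congr_fun h f

end Substitutions

section DemazureLusztig

theorem T_apply (i : ℕ) (f : R) : T i f = s i f + (1 - t) • (x i * dd i f) := rfl

theorem s_eq_sub (i : ℕ) (f : R) : s i f = f - (x i - x (i + 1)) * dd i f := by
  rw [← dd_spec, sub_sub_cancel]

theorem T_mul_of_s_eq {i : ℕ} {g : R} (hg : s i g = g) (f : R) : T i (g * f) = g * T i f := by
  have h : dd i (g * f) = g * dd i f := dd_unique (by rw [map_mul, hg, s_eq_sub]; ring)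
  rw [T_apply, T_apply, h, map_mul, hg, mul_add, mul_smul_comm, mul_left_comm]

theorem T_x_mul_of_ne {i j : ℕ} (h₁ : j ≠ i) (h₂ : j ≠ i + 1) (f : R) :
    T i (x j * f) = x j * T i f :=
  T_mul_of_s_eq (s_x_of_ne h₁ h₂) f

theorem T_x_mul (i : ℕ) (f : R) :
    T i (x i * f) = x (i + 1) * T i f + (1 - t) • (x i * f) := by
  have h : dd i (x i * f) = f + x (i + 1) * dd i f := dd_unique (by
    rw [map_mul, s_x_left, s_eq_sub]; ring)
  simp only [T_apply, h, map_mul, s_x_left, MvPolynomial.smul_eq_C_mul]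
  ring

theorem T_x_succ_mul (i : ℕ) (f : R) :
    T i (x (i + 1) * f) = x i * T i f + (t - 1) • (x i * f) := by
  have h : dd i (x (i + 1) * f) = x i * dd i f - f := dd_unique (by
    rw [map_mul, s_x_right, s_eq_sub]; ring)
  simp only [T_apply, h, map_mul, s_x_right, MvPolynomial.smul_eq_C_mul, map_sub, map_one]
  ring

theorem T_C (i : ℕ) (a : K) : T i (MvPolynomial.C a) = MvPolynomial.C a := by
  have hs : s i (MvPolynomial.C a) = MvPolynomial.C a := (s i).commutes a
  have h : dd i (MvPolynomial.C a) = 0 := dd_unique (by rw [hs, sub_self, mul_zero])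
  rw [T_apply, h, hs, mul_zero, smul_zero, add_zero]

theorem map_T {φ : R →ₐ[K] R} {i j : ℕ} (c : K) (hs : ∀ f, φ (s i f) = s j (φ f))
    (h₁ : φ (x i) = c • x j) (h₂ : φ (x (i + 1)) = c • x (j + 1)) (f : R) :
    φ (T i f) = T j (φ f) := by
  have h : dd j (φ f) = c • φ (dd i f) := dd_unique (by
    rw [← hs, ← map_sub, dd_spec, map_mul, map_sub, h₁, h₂, mul_smul_comm, ← smul_sub,
      smul_mul_assoc])
  rw [T_apply, T_apply, h, map_add, hs, map_smul, map_mul, h₁, smul_mul_assoc, mul_smul_comm]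

theorem s_T_comm {i j : ℕ} (h : i + 1 < j) (f : R) : s i (T j f) = T j (s i f) :=
  map_T 1 (s_comm h) (by rw [s_x_of_ne (by omega) (by omega), one_smul])
    (by rw [s_x_of_ne (by omega) (by omega), one_smul]) f

theorem T_comm {i j : ℕ} (h : i + 1 < j) (f : R) : T i (T j f) = T j (T i f) := by
  have hs : s j (x i - x (i + 1)) = x i - x (i + 1) := by
    rw [map_sub, s_x_of_ne (by omega) (by omega), s_x_of_ne (by omega) (by omega)]
  have hdd : dd i (T j f) = T j (dd i f) := dd_unique (by
    rw [s_T_comm h, ← map_sub, dd_spec, T_mul_of_s_eq hs])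
  rw [T_apply i, T_apply i, hdd, s_T_comm h, map_add, map_smul,
    T_x_mul_of_ne (by omega) (by omega)]

theorem T_braid (i : ℕ) (f : R) :
    T i (T (i + 1) (T i f)) = T (i + 1) (T i (T (i + 1) f)) := by
  induction f using MvPolynomial.induction_on with
  | C a => simp only [T_C]
  | add f g hf hg => simp only [map_add, hf, hg]
  | mul_X f l hf =>
    change T i (T (i + 1) (T i (f * x l))) = T (i + 1) (T i (T (i + 1) (f * x l)))
    rw [mul_comm f]
    have e₁ : ∀ g, T i (x (i + 1 + 1) * g) = x (i + 1 + 1) * T i g :=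
      T_x_mul_of_ne (by omega) (by omega)
    have e₂ : ∀ g, T (i + 1) (x i * g) = x i * T (i + 1) g := T_x_mul_of_ne (by omega) (by omega)
    by_cases hl : l = i ∨ l = i + 1 ∨ l = i + 1 + 1
    · rcases hl with rfl | rfl | rfl <;>
        simp only [T_x_mul, T_x_succ_mul, e₁, e₂, map_add, map_smul, T_T, hf] <;>
        simp only [MvPolynomial.smul_eq_C_mul, map_sub, map_one] <;>
        ring
    · have e₃ : ∀ g, T i (x l * g) = x l * T i g := T_x_mul_of_ne (by omega) (by omega)
      have e₄ : ∀ g, T (i + 1) (x l * g) = x l * T (i + 1) g :=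
        T_x_mul_of_ne (by omega) (by omega)
      simp only [e₃, e₄, hf]

theorem isHecke_T : IsHecke t T where
  ne_zero := t_ne_zero
  commute_of_lt h := LinearMap.ext fun f => T_comm h f
  braid i := LinearMap.ext fun f => T_braid i f
  mul_self i := LinearMap.ext fun f => T_T i f

theorem Tinv_apply (i : ℕ) (f : R) : Tinv i f = t⁻¹ • (T i f + (t - 1) • f) := rfl

theorem Tinv_x_mul (i : ℕ) (f : R) : Tinv i (x i * f) = t⁻¹ • (x (i + 1) * T i f) := by
  rw [Tinv_apply, T_x_mul]
  simp only [MvPolynomial.smul_eq_C_mul, map_sub, map_one]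
  ring

theorem T_x_succ_mul_eq_Tinv (i : ℕ) (f : R) : T i (x (i + 1) * f) = t • (x i * Tinv i f) := by
  rw [T_x_succ_mul, Tinv_apply, mul_smul_comm, smul_inv_smul₀ t_ne_zero, mul_add, mul_smul_comm]

theorem Tinv_x_mul_of_ne {i j : ℕ} (h₁ : j ≠ i) (h₂ : j ≠ i + 1) (f : R) :
    Tinv i (x j * f) = x j * Tinv i f := by
  rw [Tinv_apply, Tinv_apply, T_x_mul_of_ne h₁ h₂, mul_smul_comm, mul_add, mul_smul_comm]

theorem T_eq_self_iff (i : ℕ) (f : R) : T i f = f ↔ s i f = f := by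
  constructor
  · intro h
    have hmul : (x (i + 1) - MvPolynomial.C t * x i) * dd i f = 0 := by
      rw [T_apply, s_eq_sub, MvPolynomial.smul_eq_C_mul, map_sub, map_one] at h
      linear_combination h
    have hne : x (i + 1) - MvPolynomial.C t * x i ≠ 0 := fun h₀ => by
      have hkill := congrArg (kill i) h₀
      rw [map_sub, map_mul, kill_x, kill_x, if_pos rfl, if_neg (by omega), mul_zero, sub_zero,
        map_zero] at hkill
      exact x_ne_zero _ hkill
    rw [s_eq_sub, (mul_eq_zero.1 hmul).resolve_left hne, mul_zero, sub_zero]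
  · intro h
    have hdd : dd i f = 0 := dd_unique (by rw [h, sub_self, mul_zero])
    rw [T_apply, h, hdd, mul_zero, smul_zero, add_zero]

theorem proj_T {k i : ℕ} (h : i + 2 ≤ k) (f : R) : proj k (T i f) = T i (proj k f) :=
  map_T 1 (proj_s h) (by rw [proj_x, if_pos (by omega), one_smul])
    (by rw [proj_x, if_pos (by omega), one_smul]) f

theorem kill_T {n i : ℕ} (h : n < i) (f : R) : kill n (T i f) = T i (kill n f) :=
  map_T 1 (kill_s h) (by rw [kill_x, if_neg (by omega), one_smul])
    (by rw [kill_x, if_neg (by omega), one_smul]) f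

theorem cyc_T {k i : ℕ} (h : i + 2 < k) (f : R) : cyc k (T i f) = T (i + 1) (cyc k f) :=
  map_T 1 (cyc_s h) (by rw [cyc_x_of_lt (by omega), one_smul])
    (by rw [cyc_x_of_lt (by omega), one_smul]) f

theorem cyc_Tinv {k i : ℕ} (h : i + 2 < k) (f : R) :
    cyc k (Tinv i f) = Tinv (i + 1) (cyc k f) := by
  rw [Tinv_apply, Tinv_apply, map_smul, map_add, map_smul, cyc_T h]

theorem cyc_cyc_T (m : ℕ) (f : R) :
    cyc (m + 2) (cyc (m + 2) (T m f)) = T 0 (cyc (m + 2) (cyc (m + 2) f)) := by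
  have h := map_T (φ := (cyc (m + 2)).comp (cyc (m + 2))) (i := m) (j := 0) q
    (fun f => by simp only [AlgHom.comp_apply, cyc_cyc_s])
    (by rw [AlgHom.comp_apply, cyc_x_of_lt (by omega), cyc_x_last])
    (by rw [AlgHom.comp_apply, cyc_x_last, map_smul, cyc_x_of_lt (by omega)]) f
  simpa only [AlgHom.comp_apply] using h

theorem proj_cyc_T (k : ℕ) (f : R) :
    proj (k + 1) (cyc (k + 2) (T k f)) = cyc (k + 1) (proj (k + 1) f) := by
  have hx : proj (k + 1) (cyc (k + 2) (x k)) = 0 := by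
    rw [cyc_x_of_lt (by omega), proj_x, if_neg (by omega)]
  rw [T_apply, map_add, map_add, proj_cyc_s, map_smul, map_smul, map_mul, map_mul, hx, zero_mul,
    smul_zero, add_zero]

theorem proj_descProd_T {k m : ℕ} (h : m + 1 ≤ k) (f : R) :
    proj k (descProd T m f) = descProd T m (proj k f) := by
  induction m with
  | zero => rfl
  | succ m ih =>
    rw [descProd_succ, Module.End.mul_apply, proj_T (by omega), ih (by omega), Module.End.mul_apply]

theorem x_zero_dvd_descProd_T (m : ℕ) (f : R) : x 0 ∣ descProd T (m + 1) (x 1 * f) := by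
  induction m with
  | zero =>
    refine ⟨t • Tinv 0 f, ?_⟩
    rw [mul_smul_comm]
    exact T_x_succ_mul_eq_Tinv 0 f
  | succ m ih =>
    obtain ⟨g, hg⟩ := ih
    rw [descProd_succ, Module.End.mul_apply, hg, T_x_mul_of_ne (by omega) (by omega)]
    exact dvd_mul_right _ _

end DemazureLusztig

section CherednikOperators

theorem TinvChain_succ (n : ℕ) (f : R) : TinvChain (n + 1) f = Tinv n (TinvChain n f) := rfl

theorem TinvChain_eq_descProd (n : ℕ) : TinvChain n = descProd (heckeInv t T) n := by
  induction n with
  | zero => rfl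
  | succ n ih => exact congrArg (Tinv n ∘ₗ ·) ih

theorem TinvChain_T_succ {n i : ℕ} (h : i + 2 ≤ n) (f : R) :
    TinvChain n (T (i + 1) f) = T i (TinvChain n f) := by
  rw [TinvChain_eq_descProd]
  exact LinearMap.congr_fun (isHecke_T.semiconjBy_descProd_heckeInv h) f

theorem TinvChain_TinvChain_T_zero (n : ℕ) (f : R) :
    TinvChain n (TinvChain (n + 1) (T 0 f)) = T n (TinvChain n (TinvChain (n + 1) f)) := by
  rw [TinvChain_eq_descProd, TinvChain_eq_descProd]
  exact LinearMap.congr_fun (isHecke_T.semiconjBy_descProd_heckeInv_mul_descProd_heckeInv n) f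

theorem TinvChain_x_zero_mul (n : ℕ) (f : R) :
    TinvChain n (x 0 * f) = t⁻¹ ^ n • (x n * descProd T n f) := by
  induction n with
  | zero => rw [pow_zero, one_smul]; rfl
  | succ n ih =>
    rw [TinvChain_succ, ih, map_smul, Tinv_x_mul, smul_smul, pow_succ, descProd_succ,
      Module.End.mul_apply]

theorem TinvChain_T_zero_x_zero_mul (n : ℕ) (f : R) :
    TinvChain (n + 1) (T 0 (x 0 * f)) = x 0 * TinvChain (n + 1) (T 0 f) := by
  induction n with
  | zero => exact (Tinv_T 0 _).trans (congrArg (x 0 * ·) (Tinv_T 0 f).symm)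
  | succ n ih =>
    rw [TinvChain_succ, ih, Tinv_x_mul_of_ne (by omega) (by omega), TinvChain_succ (n + 1)]

theorem TinvChain_T_zero_cyc {k n : ℕ} (h : n + 1 < k) (f : R) :
    TinvChain (n + 1) (T 0 (cyc k f)) = cyc k (TinvChain n f) := by
  induction n with
  | zero => exact Tinv_T 0 _
  | succ n ih => rw [TinvChain_succ, ih (by omega), ← cyc_Tinv (by omega), TinvChain_succ]

theorem pr1_apply (f : R) : pr1 f = f - kill 0 f := rfl

theorem pr1_T {i : ℕ} (h : 0 < i) (f : R) : pr1 (T i f) = T i (pr1 f) := by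
  rw [pr1_apply, pr1_apply, kill_T h, map_sub]

theorem pr1_proj (k : ℕ) (f : R) : pr1 (proj k f) = proj k (pr1 f) := by
  rw [pr1_apply, pr1_apply, kill_proj, map_sub]

theorem pr1_x_mul {i : ℕ} (h : i ≠ 0) (f : R) : pr1 (x i * f) = x i * pr1 f := by
  rw [pr1_apply, pr1_apply, map_mul, kill_x, if_neg h, mul_sub]

theorem pr1_eq_self_of_dvd {f : R} (h : x 0 ∣ f) : pr1 f = f := by
  rw [pr1_apply, x_dvd_iff_kill_eq_zero.1 h, sub_zero]

/-- The undeformed Cherednik operator `tᵏ cyc T_{k-1}⁻¹ ⋯ T_1⁻¹` (usual numbering), which becomes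
`Ytilde k 0` when it is followed by `pr₁`. -/
def cherednik (k : ℕ) : R →ₗ[K] R := t ^ k • ((cyc k).toLinearMap ∘ₗ TinvChain (k - 1))

theorem cherednik_apply (k : ℕ) (f : R) :
    cherednik k f = t ^ k • cyc k (TinvChain (k - 1) f) := rfl

theorem Ytilde_zero_apply (k : ℕ) (f : R) : Ytilde k 0 f = pr1 (cherednik k f) := by
  rw [cherednik_apply, map_smul]
  rfl

theorem cherednik_T {k i : ℕ} (h : i + 2 < k) (f : R) :
    cherednik k (T (i + 1) f) = T (i + 1) (cherednik k f) := by
  rw [cherednik_apply, TinvChain_T_succ (by omega), cyc_T h, ← map_smul, cherednik_apply]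

theorem Ytilde_zero_T {k i : ℕ} (hi : 0 < i) (hk : i + 1 < k) (f : R) :
    Ytilde k 0 (T i f) = T i (Ytilde k 0 f) := by
  obtain ⟨i, rfl⟩ := Nat.exists_eq_add_one.2 hi
  rw [Ytilde_zero_apply, cherednik_T hk, pr1_T hi, Ytilde_zero_apply]

theorem cherednik_x_zero_mul (k : ℕ) (f : R) :
    cherednik (k + 1) (x 0 * f) = (t * q) • (x 0 * cyc (k + 1) (descProd T k f)) := by
  have ht : t ^ (k + 1) * t⁻¹ ^ k = t := by
    rw [pow_succ', mul_assoc, ← mul_pow, mul_inv_cancel₀ t_ne_zero, one_pow, mul_one]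
  rw [cherednik_apply, Nat.add_sub_cancel, TinvChain_x_zero_mul, map_smul, map_mul, cyc_x_last,
    smul_mul_assoc, smul_smul, smul_smul, ht]

theorem Ytilde_zero_of_dvd {k : ℕ} {f : R} (h : x 0 ∣ f) :
    Ytilde (k + 1) 0 f = cherednik (k + 1) f := by
  obtain ⟨g, rfl⟩ := h
  rw [Ytilde_zero_apply, cherednik_x_zero_mul, ← mul_smul_comm, pr1_eq_self_of_dvd]
  exact dvd_mul_right _ _

theorem Ytilde_zero_T_zero_x_zero_mul (k : ℕ) (f : R) :
    Ytilde (k + 2) 0 (T 0 (x 0 * f)) = x 1 * Ytilde (k + 2) 0 (T 0 f) := by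
  rw [Ytilde_zero_apply, Ytilde_zero_apply, cherednik_apply, cherednik_apply, Nat.add_succ_sub_one,
    TinvChain_T_zero_x_zero_mul, map_mul, cyc_x_of_lt (by omega), zero_add,
    ← mul_smul_comm, pr1_x_mul one_ne_zero]

theorem cherednik_T_cherednik (k : ℕ) (f : R) :
    cherednik (k + 2) (T 0 (cherednik (k + 2) f)) =
      (t ^ (k + 2) * t ^ (k + 2)) •
        cyc (k + 2) (cyc (k + 2) (TinvChain k (TinvChain (k + 1) f))) := by
  rw [cherednik_apply, cherednik_apply, Nat.add_succ_sub_one, map_smul, map_smul,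
    TinvChain_T_zero_cyc (by omega), map_smul, smul_smul]

theorem cherednik_T_cherednik_T (k : ℕ) (f : R) :
    cherednik (k + 2) (T 0 (cherednik (k + 2) (T 0 f))) =
      T 0 (cherednik (k + 2) (T 0 (cherednik (k + 2) f))) := by
  rw [cherednik_T_cherednik, cherednik_T_cherednik, TinvChain_TinvChain_T_zero, cyc_cyc_T,
    map_smul]

theorem x_zero_mul_x_one_dvd_T_zero {f : R} (h : x 0 * x 1 ∣ f) : x 0 * x 1 ∣ T 0 f := by
  obtain ⟨g, rfl⟩ := h
  rw [T_mul_of_s_eq (by rw [map_mul, s_x_left, s_x_right 0, mul_comm])]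
  exact dvd_mul_right _ _

theorem x_zero_mul_x_one_dvd_cherednik {k : ℕ} {f : R} (h : x 0 * x 1 ∣ f) :
    x 0 * x 1 ∣ cherednik (k + 2) f := by
  obtain ⟨g, rfl⟩ := h
  obtain ⟨p, hp⟩ := x_zero_dvd_descProd_T k g
  rw [mul_assoc, cherednik_x_zero_mul, hp, map_mul, cyc_x_of_lt (by omega), ← mul_assoc,
    ← mul_smul_comm]
  exact dvd_mul_right _ _

theorem x_zero_mul_x_one_dvd_Ytilde_zero {k : ℕ} {f : R} (h : x 0 * x 1 ∣ f) :
    x 0 * x 1 ∣ Ytilde (k + 2) 0 f := by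
  rw [Ytilde_zero_of_dvd ((dvd_mul_right _ _).trans h)]
  exact x_zero_mul_x_one_dvd_cherednik h

theorem Ytilde_zero_T_Ytilde_zero_T {k : ℕ} {f : R} (h : x 0 * x 1 ∣ f) :
    Ytilde (k + 2) 0 (T 0 (Ytilde (k + 2) 0 (T 0 f))) =
      T 0 (Ytilde (k + 2) 0 (T 0 (Ytilde (k + 2) 0 f))) := by
  have heq : ∀ {g : R}, x 0 * x 1 ∣ g → Ytilde (k + 2) 0 g = cherednik (k + 2) g :=
    fun hg => Ytilde_zero_of_dvd ((dvd_mul_right _ _).trans hg)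
  have hT := x_zero_mul_x_one_dvd_T_zero h
  rw [heq hT, heq (x_zero_mul_x_one_dvd_T_zero (x_zero_mul_x_one_dvd_cherednik hT)), heq h,
    heq (x_zero_mul_x_one_dvd_T_zero (x_zero_mul_x_one_dvd_cherednik h)), cherednik_T_cherednik_T]

end CherednikOperators

section InverseLimit

theorem mem_PInf_iff {F : ℕ → R} :
    F ∈ PInf ↔ ∀ k, proj k (F k) = F k ∧ proj k (F (k + 1)) = F k :=
  forall_congr' fun _ => and_congr_left' mem_P_iff

theorem proj_of_mem_PInf {F : ℕ → R} (hF : F ∈ PInf) {k m : ℕ} (h : k ≤ m) :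
    proj k (F m) = F k := by
  rw [mem_PInf_iff] at hF
  induction m, h using Nat.le_induction with
  | base => exact (hF k).1
  | succ m h ih => rw [← ih, ← (hF m).2, proj_proj h]

theorem PInf_ext {F G : ℕ → R} (hF : F ∈ PInf) (hG : G ∈ PInf)
    (h : ∀ᶠ k in atTop, F k = G k) : F = G := by
  obtain ⟨N, hN⟩ := eventually_atTop.1 h
  funext k
  rw [← proj_of_mem_PInf hF (le_max_left k N), ← proj_of_mem_PInf hG (le_max_left k N),
    hN _ (le_max_right k N)]

/-- A sequence that is compatible with the inverse system from the index `m` on. -/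
def IsCompatibleFrom (m : ℕ) (f : ℕ → R) : Prop :=
  ∀ k, m ≤ k → proj k (f k) = f k ∧ proj k (f (k + 1)) = f k

/-- The element of the inverse limit given by a sequence that is compatible from the index `m`
on; the first `m` terms of the sequence are ignored. -/
def extend (m : ℕ) (f : ℕ → R) : ℕ → R := fun k => proj k (f (max k m))

theorem extend_apply {m : ℕ} {f : ℕ → R} (hf : IsCompatibleFrom m f) {k : ℕ} (h : m ≤ k) :
    extend m f k = f k := by
  rw [extend, max_eq_left h, (hf k h).1]

theorem extend_mem_PInf {m : ℕ} {f : ℕ → R} (hf : IsCompatibleFrom m f) : extend m f ∈ PInf := by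
  refine mem_PInf_iff.2 fun k => ⟨proj_proj le_rfl _, ?_⟩
  rw [extend, extend, proj_proj k.le_succ]
  rcases Nat.lt_or_ge k m with h | h
  · rw [max_eq_right h, max_eq_right h.le]
  · rw [max_eq_left h, max_eq_left (by omega), (hf k h).2, (hf k h).1]

theorem isCompatibleFrom_T {F : ℕ → R} (hF : F ∈ PInf) (i : ℕ) :
    IsCompatibleFrom (i + 2) fun k => T i (F k) := fun k hk => by
  rw [proj_T hk, proj_T hk, (mem_PInf_iff.1 hF k).1, (mem_PInf_iff.1 hF k).2]
  exact ⟨rfl, rfl⟩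

theorem limT_eq_extend (i : ℕ) (F : ℕ → R) : limT i F = extend (i + 2) fun k => T i (F k) := rfl

theorem limT_apply {F : ℕ → R} (hF : F ∈ PInf) {i k : ℕ} (h : i + 2 ≤ k) :
    limT i F k = T i (F k) := by
  rw [limT_eq_extend, extend_apply (isCompatibleFrom_T hF i) h]

theorem limX_apply (F : ℕ → R) {i k : ℕ} (h : i < k) : limX i F k = x i * F k := by
  change proj k (x i) * F k = _
  rw [proj_x, if_pos h]

theorem limX_mem_PInf {F : ℕ → R} (hF : F ∈ PInf) (i : ℕ) : limX i F ∈ PInf :=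
  mem_PInf_iff.2 fun k => by
    change proj k (proj k (x i) * F k) = _ ∧ proj k (proj (k + 1) (x i) * F (k + 1)) = _
    rw [map_mul, map_mul, proj_proj le_rfl, proj_proj k.le_succ, (mem_PInf_iff.1 hF k).1,
      (mem_PInf_iff.1 hF k).2]
    exact ⟨rfl, rfl⟩

theorem x_dvd_of_eventually {F : ℕ → R} (hF : F ∈ PInf) {n : ℕ}
    (h : ∀ᶠ k in atTop, x n ∣ F k) {k : ℕ} (hk : n < k) : x n ∣ F k := by
  obtain ⟨N, hN⟩ := eventually_atTop.1 h
  have hdvd := map_dvd (proj k) (hN _ (le_max_right k N))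
  rwa [proj_of_mem_PInf hF (le_max_left k N), proj_x, if_pos hk] at hdvd

theorem isCompatibleFrom_of_limX {F b : ℕ → R} (hF : F ∈ PInf) {n : ℕ}
    (hb : ∀ k, n < k → F k = x n * b k) : IsCompatibleFrom (n + 1) b := fun k hk => by
  have hx : proj k (x n) = x n := by rw [proj_x, if_pos (by omega)]
  have hFk := mem_PInf_iff.1 hF k
  constructor <;> apply mul_left_cancel₀ (x_ne_zero n)
  · rw [← hb k hk, ← hFk.1, hb k hk, map_mul, hx]
  · rw [← hb k hk, ← hFk.2, hb (k + 1) (by omega), map_mul, hx]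

end InverseLimit

section Degree

theorem totalDegree_aeval_le {σ τ A : Type*} [CommSemiring A] {g : σ → MvPolynomial τ A}
    (hg : ∀ j, (g j).totalDegree ≤ 1) (f : MvPolynomial σ A) :
    (MvPolynomial.aeval g f).totalDegree ≤ f.totalDegree := by
  rw [MvPolynomial.aeval_def, MvPolynomial.eval₂_eq]
  refine MvPolynomial.totalDegree_finsetSum_le fun d hd => ?_
  refine (MvPolynomial.totalDegree_mul _ _).trans ?_
  rw [MvPolynomial.algebraMap_eq, MvPolynomial.totalDegree_C, zero_add]
  refine (MvPolynomial.totalDegree_finsetProd _ _).trans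
    (le_trans (Finset.sum_le_sum fun i _ => ?_) (MvPolynomial.le_totalDegree hd))
  exact (MvPolynomial.totalDegree_pow _ _).trans (by simpa using Nat.mul_le_mul_left (d i) (hg i))

theorem totalDegree_x (i : ℕ) : (x i).totalDegree = 1 := MvPolynomial.totalDegree_X i

theorem totalDegree_proj_le (k : ℕ) (f : R) : (proj k f).totalDegree ≤ f.totalDegree :=
  totalDegree_aeval_le (fun j => by split_ifs <;> simp [totalDegree_x]) f

theorem totalDegree_kill_le (k : ℕ) (f : R) : (kill k f).totalDegree ≤ f.totalDegree :=
  totalDegree_aeval_le (fun j => by split_ifs <;> simp [totalDegree_x]) f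

theorem totalDegree_cyc_le (k : ℕ) (f : R) : (cyc k f).totalDegree ≤ f.totalDegree :=
  totalDegree_aeval_le (fun j => by
    split_ifs
    · exact (totalDegree_x _).le
    · exact (MvPolynomial.totalDegree_smul_le _ _).trans (totalDegree_x _).le
    · exact (totalDegree_x _).le) f

theorem totalDegree_pr1_le (f : R) : (pr1 f).totalDegree ≤ f.totalDegree := by
  rw [pr1_apply]
  exact (MvPolynomial.totalDegree_sub _ _).trans (max_le le_rfl (totalDegree_kill_le 0 f))

theorem totalDegree_x_mul {f : R} (i : ℕ) (hf : f ≠ 0) :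
    (x i * f).totalDegree = f.totalDegree + 1 := by
  rw [MvPolynomial.totalDegree_mul_of_isDomain (x_ne_zero i) hf, totalDegree_x, add_comm]

theorem totalDegree_le_x_mul (i : ℕ) (f : R) : f.totalDegree ≤ (x i * f).totalDegree := by
  rcases eq_or_ne f 0 with rfl | hf
  · rw [mul_zero]
  · exact (totalDegree_x_mul i hf).symm ▸ Nat.le_succ _

theorem totalDegree_s_le (i : ℕ) (f : R) : (s i f).totalDegree ≤ f.totalDegree :=
  MvPolynomial.totalDegree_rename_le _ _

theorem totalDegree_x_sub (i : ℕ) : (x i - x (i + 1)).totalDegree = 1 :=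
  ((MvPolynomial.isHomogeneous_X K i).sub (MvPolynomial.isHomogeneous_X K (i + 1))).totalDegree
    (x_sub_ne_zero i)

theorem totalDegree_x_mul_dd_le (i : ℕ) (f : R) : (x i * dd i f).totalDegree ≤ f.totalDegree := by
  rcases eq_or_ne (dd i f) 0 with h | h
  · simp only [h, mul_zero, MvPolynomial.totalDegree_zero, Nat.zero_le]
  · calc (x i * dd i f).totalDegree
      _ = ((x i - x (i + 1)) * dd i f).totalDegree := by
          rw [totalDegree_x_mul i h, MvPolynomial.totalDegree_mul_of_isDomain (x_sub_ne_zero i) h,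
            totalDegree_x_sub, add_comm]
      _ = (f - s i f).totalDegree := by rw [dd_spec]
      _ ≤ f.totalDegree :=
          (MvPolynomial.totalDegree_sub _ _).trans (max_le le_rfl (totalDegree_s_le i f))

theorem totalDegree_T_le (i : ℕ) (f : R) : (T i f).totalDegree ≤ f.totalDegree :=
  (MvPolynomial.totalDegree_add _ _).trans (max_le (totalDegree_s_le i f)
    ((MvPolynomial.totalDegree_smul_le _ _).trans (totalDegree_x_mul_dd_le i f)))

theorem totalDegree_descProd_T_le (m : ℕ) (f : R) :
    (descProd T m f).totalDegree ≤ f.totalDegree := by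
  induction m with
  | zero => exact le_rfl
  | succ m ih => exact (totalDegree_T_le m _).trans ih

theorem totalDegree_le_of_mem_PInf {F : ℕ → R} (hF : F ∈ PInf) {k m : ℕ} (h : k ≤ m) :
    (F k).totalDegree ≤ (F m).totalDegree :=
  proj_of_mem_PInf hF h ▸ totalDegree_proj_le k (F m)

end Degree

/-- A submodule of the inverse limit that contains all elements whose degrees are bounded, up to
a shift, by those of an element of it. The two versions of `𝒫_∞⁺` are instances. -/
structure IsDegreeClosed (L : Submodule K (ℕ → R)) : Prop where
  le : L ≤ PInf
  mem : ∀ F ∈ L, ∀ G ∈ PInf, ∀ c : ℕ,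
    (∀ k, (G k).totalDegree ≤ (F (k + c)).totalDegree + c) → G ∈ L

theorem isDegreeClosed_PInf : IsDegreeClosed PInf := ⟨le_rfl, fun _ _ _ hG _ _ => hG⟩

theorem isDegreeClosed_PInfGr : IsDegreeClosed PInfGr where
  le _ hF := hF.1
  mem := by
    rintro F ⟨-, d, hd⟩ G hG c h
    exact ⟨hG, d + c, fun k => (h k).trans (Nat.add_le_add_right (hd _) c)⟩

namespace IsDegreeClosed

variable {L : Submodule K (ℕ → R)}

theorem extend_mem (hL : IsDegreeClosed L) {F : ℕ → R} (hF : F ∈ L) {m : ℕ} {f : ℕ → R}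
    (hf : IsCompatibleFrom m f) (c : ℕ)
    (h : ∀ k, m ≤ k → (f k).totalDegree ≤ (F (k + c)).totalDegree + c) : extend m f ∈ L := by
  refine hL.mem F hF _ (extend_mem_PInf hf) (m + c) fun k => ?_
  calc (extend m f k).totalDegree
    _ ≤ (f (max k m)).totalDegree := totalDegree_proj_le _ _
    _ ≤ (F (max k m + c)).totalDegree + c := h _ (le_max_right k m)
    _ ≤ (F (k + (m + c))).totalDegree + (m + c) :=
        add_le_add (totalDegree_le_of_mem_PInf (hL.le hF) (by omega)) (by omega)

theorem limT_mem (hL : IsDegreeClosed L) {F : ℕ → R} (hF : F ∈ L) (i : ℕ) : limT i F ∈ L := by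
  rw [limT_eq_extend]
  exact hL.extend_mem hF (isCompatibleFrom_T (hL.le hF) i) 0 fun k _ => totalDegree_T_le _ _

theorem limX_mem (hL : IsDegreeClosed L) {F : ℕ → R} (hF : F ∈ L) (i : ℕ) : limX i F ∈ L := by
  refine hL.mem F hF _ (limX_mem_PInf (hL.le hF) i) 1 fun k => ?_
  calc (proj k (x i) * F k).totalDegree
    _ ≤ (proj k (x i)).totalDegree + (F k).totalDegree := MvPolynomial.totalDegree_mul _ _
    _ ≤ 1 + (F (k + 1)).totalDegree :=
        add_le_add ((totalDegree_proj_le _ _).trans (totalDegree_x i).le)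
          (totalDegree_le_of_mem_PInf (hL.le hF) k.le_succ)
    _ = (F (k + 1)).totalDegree + 1 := add_comm _ _

theorem mem_PSym_iff (hL : IsDegreeClosed L) {F : ℕ → R} {n : ℕ} :
    F ∈ PSym L n ↔ F ∈ L ∧ ∀ i k, n ≤ i → i + 2 ≤ k → s i (F k) = F k := by
  refine and_congr_right fun hF => ⟨fun h i k hi hk => ?_, fun h i hi => ?_⟩
  · rw [← T_eq_self_iff, ← limT_apply (hL.le hF) hk, h i hi]
  · refine PInf_ext (hL.le (hL.limT_mem hF i)) (hL.le hF) ?_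
    filter_upwards [eventually_ge_atTop (i + 2)] with k hk
    rw [limT_apply (hL.le hF) hk, T_eq_self_iff, h i k hi hk]

theorem exists_limX_eq (hL : IsDegreeClosed L) {F : ℕ → R} (hF : F ∈ L) {n : ℕ}
    (h : ∀ᶠ k in atTop, x n ∣ F k) : ∃ B ∈ L, F = limX n B := by
  choose! b hb using fun k => x_dvd_of_eventually (hL.le hF) h (k := k)
  have hcomp := isCompatibleFrom_of_limX (hL.le hF) hb
  have hB : extend (n + 1) b ∈ L := hL.extend_mem hF hcomp 0 fun k hk =>
    (totalDegree_le_x_mul n _).trans (hb k hk ▸ le_rfl)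
  refine ⟨_, hB, PInf_ext (hL.le hF) (hL.le (hL.limX_mem hB n)) ?_⟩
  filter_upwards [eventually_gt_atTop n] with k hk
  rw [limX_apply _ hk, extend_apply hcomp hk, hb k hk]

end IsDegreeClosed

section Decomposition

/-- The substitution `f ↦ f(x_0, …, x_{n-1}, 0, x_n, x_{n+1}, …)` (numbering of this file). -/
def insertZero (n : ℕ) : R →ₐ[K] R :=
  MvPolynomial.aeval fun j => if j < n then x j else if j = n then (0 : R) else x (j - 1)

theorem insertZero_x (n j : ℕ) :
    insertZero n (x j) = if j < n then x j else if j = n then 0 else x (j - 1) :=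
  MvPolynomial.aeval_X _ j

theorem totalDegree_insertZero_le (n : ℕ) (f : R) :
    (insertZero n f).totalDegree ≤ f.totalDegree :=
  totalDegree_aeval_le (fun j => by split_ifs <;> simp [totalDegree_x]) f

theorem insertZero_succ_s (n : ℕ) (f : R) : insertZero (n + 1) (s n f) = insertZero n f :=
  algHom_comp_apply_eq (ψ' := AlgHom.id K R) (fun j => by
    simp only [s_x_eq_ite, insertZero_x, AlgHom.id_apply]
    split_ifs <;> simp [insertZero_x] <;> grind) f

theorem proj_insertZero {n k : ℕ} (h : n ≤ k) (f : R) :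
    proj k (insertZero n f) = insertZero n (proj (k + 1) f) :=
  algHom_comp_apply_eq (fun j => by
    simp only [proj_x, insertZero_x]
    split_ifs <;> simp [insertZero_x, proj_x] <;> grind) f

theorem s_insertZero {n i : ℕ} (h : n ≤ i) (f : R) :
    s i (insertZero n f) = insertZero n (s (i + 1) f) :=
  algHom_comp_apply_eq (fun j => by
    simp only [s_x_eq_ite, insertZero_x]
    split_ifs <;> simp [insertZero_x, s_x_eq_ite] <;> grind) f

theorem kill_insertZero (n : ℕ) (f : R) :
    kill n (insertZero n f) = kill n (insertZero (n + 1) f) :=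
  algHom_comp_apply_eq (fun j => by
    simp only [insertZero_x]
    split_ifs <;> simp [kill_x] <;> grind) f

theorem insertZero_proj (k : ℕ) (f : R) : insertZero k (proj (k + 1) f) = proj k f :=
  algHom_comp_apply_eq (ψ' := AlgHom.id K R) (fun j => by
    simp only [proj_x, AlgHom.id_apply]
    split_ifs <;> simp [insertZero_x] <;> grind) f

variable {L : Submodule K (ℕ → R)}

theorem insertZero_of_mem_PSym (hL : IsDegreeClosed L) {F : ℕ → R} {n : ℕ} (hF : F ∈ PSym L n)
    {k : ℕ} (hk : n ≤ k) : insertZero n (F (k + 1)) = F k := by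
  obtain ⟨hFL, hs⟩ := hL.mem_PSym_iff.1 hF
  have hFk := mem_PInf_iff.1 (hL.le hFL)
  induction hk using Nat.decreasingInduction with
  | self => rw [← (hFk (k + 1)).1, insertZero_proj, (hFk k).2]
  | of_succ m hm ih =>
    rw [← insertZero_succ_s, hs m _ le_rfl (by omega)]
    exact ih ⟨hFL, fun i hi => hF.2 i (by omega)⟩ fun i l hi => hs i l (by omega)

theorem exists_mem_PSym_x_dvd_sub (hL : IsDegreeClosed L) {F : ℕ → R} {n : ℕ}
    (hF : F ∈ PSym L (n + 1)) :
    ∃ A ∈ PSym L n, ∀ᶠ k in atTop, x n ∣ (F - A) k := by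
  obtain ⟨hFL, hs⟩ := hL.mem_PSym_iff.1 hF
  have hFk := mem_PInf_iff.1 (hL.le hFL)
  have hcomp : IsCompatibleFrom n fun k => insertZero n (F (k + 1)) := fun k hk => by
    rw [proj_insertZero hk, proj_insertZero hk, (hFk (k + 1)).1, (hFk (k + 1)).2]
    exact ⟨rfl, rfl⟩
  refine ⟨extend n fun k => insertZero n (F (k + 1)), hL.mem_PSym_iff.2 ⟨?_, ?_⟩, ?_⟩
  · exact hL.extend_mem hFL hcomp 1 fun k _ =>
      (totalDegree_insertZero_le _ _).trans (Nat.le_succ _)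
  · intro i k hi hk
    rw [extend_apply hcomp (by omega), s_insertZero hi, hs (i + 1) (k + 1) (by omega) (by omega)]
  · filter_upwards [eventually_gt_atTop n] with k hk
    rw [x_dvd_iff_kill_eq_zero, Pi.sub_apply, map_sub, extend_apply hcomp hk.le, kill_insertZero,
      insertZero_of_mem_PSym hL hF hk, sub_self]

theorem mem_PSym_of_limX_mem_PSym (hL : IsDegreeClosed L) {F : ℕ → R} {n : ℕ} (hF : F ∈ L)
    (h : limX n F ∈ PSym L (n + 1)) : F ∈ PSym L (n + 1) := by
  refine hL.mem_PSym_iff.2 ⟨hF, fun i k hi hk => mul_left_cancel₀ (x_ne_zero n) ?_⟩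
  have hs := (hL.mem_PSym_iff.1 h).2 i k hi hk
  rwa [limX_apply F (by omega), map_mul, s_x_of_ne (by omega) (by omega)] at hs

theorem exists_eq_add_limX (hL : IsDegreeClosed L) {F : ℕ → R} {n : ℕ}
    (hF : F ∈ PSym L (n + 1)) :
    ∃ A ∈ PSym L n, ∃ B ∈ PSym L (n + 1), F = A + limX n B := by
  obtain ⟨A, hA, hdvd⟩ := exists_mem_PSym_x_dvd_sub hL hF
  have hA' : A ∈ PSym L (n + 1) := ⟨hA.1, fun i hi => hA.2 i (by omega)⟩
  obtain ⟨B, hB, hFB⟩ := hL.exists_limX_eq (L.sub_mem hF.1 hA.1) hdvd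
  refine ⟨A, hA, B, mem_PSym_of_limX_mem_PSym hL hB ?_, ?_⟩
  · exact hFB ▸ (PSym L (n + 1)).sub_mem hF hA'
  · rw [← hFB, add_sub_cancel]

end Decomposition

section OrderOfVanishing

theorem isPrime_span_X_zero : (Ideal.span {(MvPolynomial.X 0 : Pol)}).IsPrime :=
  (Ideal.span_singleton_prime (MvPolynomial.X_ne_zero 0)).2 MvPolynomial.X_prime

/-- The local ring of the line `t = 0`: the elements of `ℚ(t, q)` without a pole along that
line. -/
def regularAtZero : Subalgebra Pol K :=
  haveI := isPrime_span_X_zero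
  Localization.subalgebra.ofField K (Ideal.span {(MvPolynomial.X 0 : Pol)}).primeCompl
    (Ideal.primeCompl_le_nonZeroDivisors _)

theorem mem_regularAtZero_iff {a : K} : a ∈ regularAtZero ↔
    ∃ A B : Pol, ¬ MvPolynomial.X 0 ∣ B ∧ a = algebraMap Pol K A / algebraMap Pol K B := by
  change (∃ A B, ∃ _ : ¬ B ∈ Ideal.span _, a = _ * _) ↔ _
  simp only [Ideal.mem_span_singleton, exists_prop, div_eq_mul_inv]

theorem t_mem_regularAtZero : t ∈ regularAtZero := regularAtZero.algebraMap_mem _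

theorem algebraMap_ne_zero_of_not_dvd {B : Pol} (hB : ¬ MvPolynomial.X 0 ∣ B) :
    algebraMap Pol K B ≠ 0 := by
  rw [Ne, FaithfulSMul.algebraMap_eq_zero_iff]
  rintro rfl
  exact hB (dvd_zero _)

theorem inv_t_notMem_regularAtZero : t⁻¹ ∉ regularAtZero := by
  rw [mem_regularAtZero_iff]
  rintro ⟨A, B, hB, h⟩
  rw [eq_div_iff (algebraMap_ne_zero_of_not_dvd hB), inv_mul_eq_iff_eq_mul₀ t_ne_zero, t,
    ← map_mul] at h
  exact hB ⟨A, FaithfulSMul.algebraMap_injective Pol K h⟩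

theorem exists_eq_X_zero_pow_mul {B : Pol} (hB : B ≠ 0) :
    ∃ (n : ℕ) (C : Pol), B = MvPolynomial.X 0 ^ n * C ∧ ¬ MvPolynomial.X 0 ∣ C :=
  ⟨_, (FiniteMultiplicity.of_prime_left MvPolynomial.X_prime hB).exists_eq_pow_mul_and_not_dvd⟩

theorem exists_t_pow_mul_mem_regularAtZero (a : K) : ∃ r, t ^ r * a ∈ regularAtZero := by
  obtain ⟨A, B, hB, rfl⟩ := IsFractionRing.div_surjective (A := Pol) a
  obtain ⟨r, C, rfl, hC⟩ := exists_eq_X_zero_pow_mul (nonZeroDivisors.ne_zero hB)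
  refine ⟨r, mem_regularAtZero_iff.2 ⟨A, C, hC, ?_⟩⟩
  rw [map_mul, map_pow, ← t, div_mul_eq_div_div_swap,
    mul_div_cancel₀ _ (pow_ne_zero r t_ne_zero)]

theorem ordGE_iff {M : ℕ} {a : K} : OrdGE M a ↔ ∃ b ∈ regularAtZero, a = t ^ M * b := by
  constructor
  · rintro ⟨A, B, hB, rfl, h⟩
    obtain ⟨n, C, rfl, hC⟩ := exists_eq_X_zero_pow_mul hB
    obtain ⟨D, rfl⟩ : (MvPolynomial.X 0 : Pol) ^ (M + n) ∣ A := by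
      refine pow_dvd_of_le_emultiplicity (le_trans ?_ h)
      rw [Nat.cast_add]
      exact add_le_add_right (le_emultiplicity_of_pow_dvd (dvd_mul_right _ _)) _
    refine ⟨_, mem_regularAtZero_iff.2 ⟨D, C, hC, rfl⟩, ?_⟩
    have := pow_ne_zero n t_ne_zero
    rw [map_mul, map_mul, map_pow, map_pow, ← t, pow_add]
    field_simp
  · rintro ⟨b, hb, rfl⟩
    obtain ⟨A, B, hB, rfl⟩ := mem_regularAtZero_iff.1 hb
    refine ⟨MvPolynomial.X 0 ^ M * A, B, fun h => hB (h ▸ dvd_zero _), ?_, ?_⟩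
    · rw [map_mul, map_pow, ← t, mul_div_assoc]
    · rw [emultiplicity_eq_zero.2 hB, add_zero]
      exact le_emultiplicity_of_pow_dvd (dvd_mul_right _ _)

theorem OrdGE.add {M : ℕ} {a b : K} (ha : OrdGE M a) (hb : OrdGE M b) : OrdGE M (a + b) := by
  rw [ordGE_iff] at *
  obtain ⟨a, ha, rfl⟩ := ha
  obtain ⟨b, hb, rfl⟩ := hb
  exact ⟨a + b, add_mem ha hb, (mul_add _ _ _).symm⟩

theorem ordGE_zero (M : ℕ) : OrdGE M 0 :=
  ordGE_iff.2 ⟨0, zero_mem _, (mul_zero _).symm⟩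

theorem ordGE_t_pow {M n : ℕ} (h : M ≤ n) : OrdGE M (t ^ n) :=
  ordGE_iff.2 ⟨t ^ (n - M), pow_mem t_mem_regularAtZero _, (pow_mul_pow_sub t h).symm⟩

theorem exists_ordGE_mul (c : K) : ∃ r, ∀ M a, OrdGE (M + r) a → OrdGE M (c * a) := by
  obtain ⟨r, hr⟩ := exists_t_pow_mul_mem_regularAtZero c
  refine ⟨r, fun M a ha => ?_⟩
  obtain ⟨b, hb, rfl⟩ := ordGE_iff.1 ha
  exact ordGE_iff.2 ⟨_, mul_mem hr hb, by ring⟩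

theorem eq_zero_of_forall_ordGE {a : K} (h : ∀ M, OrdGE M a) : a = 0 := by
  by_contra ha
  obtain ⟨r, hr⟩ := exists_t_pow_mul_mem_regularAtZero a⁻¹
  obtain ⟨b, hb, hab⟩ := ordGE_iff.1 (h (r + 1))
  refine inv_t_notMem_regularAtZero ?_
  have hinv : t⁻¹ = t ^ r * a⁻¹ * b := by
    have := t_ne_zero
    field_simp
    rw [hab]
    ring
  exact hinv ▸ mul_mem hr hb

namespace ScalarTendsTo

theorem const (a : K) : ScalarTendsTo (fun _ => a) a := fun M => by
  simp only [sub_self, ordGE_zero, eventually_true]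

theorem add {a b : ℕ → K} {α β : K} (ha : ScalarTendsTo a α) (hb : ScalarTendsTo b β) :
    ScalarTendsTo (fun k => a k + b k) (α + β) := fun M => by
  filter_upwards [ha M, hb M] with k hak hbk
  rw [add_sub_add_comm]
  exact hak.add hbk

theorem const_mul {a : ℕ → K} {α : K} (ha : ScalarTendsTo a α) (c : K) :
    ScalarTendsTo (fun k => c * a k) (c * α) := fun M => by
  obtain ⟨r, hr⟩ := exists_ordGE_mul c
  filter_upwards [ha (M + r)] with k hk
  rw [← mul_sub]
  exact hr _ _ hk

theorem sum {ι : Type*} {I : Finset ι} {a : ι → ℕ → K} {α : ι → K}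
    (h : ∀ j ∈ I, ScalarTendsTo (a j) (α j)) :
    ScalarTendsTo (fun k => ∑ j ∈ I, a j k) (∑ j ∈ I, α j) := by
  classical
  induction I using Finset.induction_on with
  | empty => exact const 0
  | insert i I hi ih =>
    simp only [Finset.sum_insert hi]
    rw [Finset.forall_mem_insert] at h
    exact h.1.add (ih h.2)

theorem congr {a b : ℕ → K} {α : K} (ha : ScalarTendsTo a α) (h : ∀ᶠ k in atTop, a k = b k) :
    ScalarTendsTo b α := fun M => by
  filter_upwards [ha M, h] with k hak hk
  rwa [← hk]

theorem unique {a : ℕ → K} {α β : K} (hα : ScalarTendsTo a α) (hβ : ScalarTendsTo a β) :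
    α = β := by
  refine sub_eq_zero.1 (eq_zero_of_forall_ordGE fun M => ?_)
  obtain ⟨k, hk⟩ := ((hβ.add (hα.const_mul (-1))) M).exists
  convert hk using 1
  ring

theorem t_pow : ScalarTendsTo (fun k => t ^ k) 0 := fun M => by
  filter_upwards [eventually_ge_atTop M] with k hk
  rw [sub_zero]
  exact ordGE_t_pow hk

end ScalarTendsTo

end OrderOfVanishing

section Convergence

variable {L : Submodule K (ℕ → R)}

theorem PAs_le (L : Submodule K (ℕ → R)) : PAs L ≤ L := fun _ ⟨_, hF⟩ => hF.1

namespace ConvergesTo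

theorem congr {f g F : ℕ → R} (h : ConvergesTo L f F) (hfg : ∀ᶠ k in atTop, f k = g k) :
    ConvergesTo L g F := by
  obtain ⟨N, h, u, a, b, hh, hu, hab, hf, rfl⟩ := h
  exact ⟨N, h, u, a, b, hh, hu, hab, (hfg.mp (hf.mono fun k hk e => e ▸ hk)), rfl⟩

theorem add {f g F G : ℕ → R} (hf : ConvergesTo L f F) (hg : ConvergesTo L g G) :
    ConvergesTo L (f + g) (F + G) := by
  obtain ⟨N, h, u, a, b, hh, hu, hab, hf, rfl⟩ := hf
  obtain ⟨N', h', u', a', b', hh', hu', hab', hg, rfl⟩ := hg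
  refine ⟨N + N', h + h', Fin.append u u', Fin.append a a', Fin.append b b', L.add_mem hh hh',
    Fin.addCases (by simpa only [Fin.append_left] using hu)
      (by simpa only [Fin.append_right] using hu'),
    Fin.addCases (by simpa only [Fin.append_left] using hab)
      (by simpa only [Fin.append_right] using hab'), ?_, ?_⟩
  · filter_upwards [hf, hg] with k hfk hgk
    simp only [Pi.add_apply, hfk, hgk, Fin.sum_univ_add, Fin.append_left, Fin.append_right]
    abel
  · simp only [Fin.sum_univ_add, Fin.append_left, Fin.append_right]
    abel

theorem of_eventually_eq_add_t_pow {f F E : ℕ → R} (hF : F ∈ L) (hE : E ∈ PAs L)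
    (h : ∀ᶠ k in atTop, f k = F k + t ^ k • E k) : ConvergesTo L f F :=
  ⟨1, F, fun _ => E, fun _ k => t ^ k, fun _ => 0, hF, fun _ => hE,
    fun _ => ScalarTendsTo.t_pow, by simpa using h, by simp⟩

theorem of_eventually_eq {f F : ℕ → R} (hF : F ∈ L) (h : ∀ᶠ k in atTop, f k = F k) :
    ConvergesTo L f F :=
  of_eventually_eq_add_t_pow hF (zero_mem _) (by simpa using h)

/-- Linear functionals on the polynomials detect the limit because the terms of a convergent
sequence are combinations of finitely many elements of the inverse limit, whose images under
`proj k` are eventually constant. -/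
theorem scalarTendsTo_proj (hL : L ≤ PInf) {f F : ℕ → R} (h : ConvergesTo L f F)
    (ℓ : R →ₗ[K] K) (k : ℕ) : ScalarTendsTo (fun m => ℓ (proj k (f m))) (ℓ (F k)) := by
  obtain ⟨N, h, u, a, b, hh, hu, hab, hf, rfl⟩ := h
  have hlim : ScalarTendsTo (fun m => ℓ (h k) + ∑ j, ℓ (u j k) * a j m)
      (ℓ (h k) + ∑ j, ℓ (u j k) * b j) :=
    (ScalarTendsTo.const _).add (ScalarTendsTo.sum fun j _ => (hab j).const_mul _)
  have hF : ℓ ((h + ∑ j, b j • u j) k) = ℓ (h k) + ∑ j, ℓ (u j k) * b j := by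
    simp [mul_comm]
  rw [hF]
  refine hlim.congr ?_
  filter_upwards [hf, eventually_ge_atTop k] with m hm hkm
  rw [hm]
  simp only [map_add, map_sum, map_smul, proj_of_mem_PInf (hL hh) hkm,
    proj_of_mem_PInf (hL (PAs_le L (hu _))) hkm, smul_eq_mul, mul_comm]

theorem unique (hL : L ≤ PInf) {f F G : ℕ → R} (hF : ConvergesTo L f F)
    (hG : ConvergesTo L f G) : F = G := by
  funext k
  refine sub_eq_zero.1 ((Module.forall_dual_apply_eq_zero_iff K _).1 fun ℓ => ?_)
  rw [map_sub, sub_eq_zero]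
  exact (hF.scalarTendsTo_proj hL ℓ k).unique (hG.scalarTendsTo_proj hL ℓ k)

theorem map {f F : ℕ → R} (h : ConvergesTo L f F) (φ : R →ₗ[K] R)
    (Φ : (ℕ → R) →ₗ[K] (ℕ → R)) (hΦL : ∀ G ∈ L, Φ G ∈ L) (hΦ : ∀ G ∈ PAs L, Φ G ∈ PAs L)
    (hφ : ∀ G ∈ L, ∀ᶠ k in atTop, Φ G k = φ (G k)) :
    ConvergesTo L (fun k => φ (f k)) (Φ F) := by
  obtain ⟨N, h, u, a, b, hh, hu, hab, hf, rfl⟩ := h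
  refine ⟨N, Φ h, fun j => Φ (u j), a, b, hΦL h hh, fun j => hΦ _ (hu j), hab, ?_, ?_⟩
  · have hφu : ∀ᶠ k in atTop, ∀ j, Φ (u j) k = φ (u j k) :=
      eventually_all.2 fun j => hφ _ (PAs_le L (hu j))
    filter_upwards [hf, hφ h hh, hφu] with k hfk hhk huk
    simp only [hfk, map_add, map_sum, map_smul, hhk, huk]
  · simp only [map_add, map_sum, map_smul]

theorem smul {f F : ℕ → R} (h : ConvergesTo L f F) (c : K) :
    ConvergesTo L (fun k => c • f k) (c • F) :=
  h.map (c • LinearMap.id) (c • LinearMap.id) (fun _ => L.smul_mem c)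
    (fun _ => (PAs L).smul_mem c) fun _ _ => Eventually.of_forall fun _ => rfl

end ConvergesTo

end Convergence

section FirstCherednikOperator

variable {L : Submodule K (ℕ → R)}

theorem TinvChain_ascProd_T (n : ℕ) (f : R) : TinvChain n (ascProd T n f) = f := by
  induction n generalizing f with
  | zero => rfl
  | succ n ih => rw [TinvChain_succ, ascProd_succ, Module.End.mul_apply, ih, Tinv_T]

theorem TinvChain_ascProd_T_of_le {n m : ℕ} (h : n ≤ m) {f : R}
    (hf : ∀ i, n ≤ i → i < m → T i f = f) : TinvChain m (ascProd T n f) = f := by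
  induction m, h using Nat.le_induction with
  | base => exact TinvChain_ascProd_T n f
  | succ m h ih =>
    rw [TinvChain_succ, ih fun i hi him => hf i hi (by omega)]
    conv_lhs => rw [← hf m h m.lt_succ_self]
    exact Tinv_T m f

theorem exists_eventually_Ytilde_zero_eq (hL : IsDegreeClosed L) {F : ℕ → R} (hF : F ∈ L)
    (hdvd : ∀ᶠ k in atTop, x 0 ∣ F k) :
    ∃ H ∈ L, ∀ᶠ k in atTop, Ytilde k 0 (F k) = H k := by
  obtain ⟨G, hG, rfl⟩ := hL.exists_limX_eq hF hdvd
  have hGk := mem_PInf_iff.1 (hL.le hG)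
  have hf : IsCompatibleFrom 1 fun k => (t * q) • (x 0 * cyc k (descProd T (k - 1) (G k))) := by
    intro k hk
    obtain ⟨m, rfl⟩ := Nat.exists_eq_add_one.2 hk
    have hx : proj (m + 1) (x 0) = x 0 := by rw [proj_x, if_pos m.succ_pos]
    simp only [map_smul, map_mul, hx, Nat.add_sub_cancel]
    constructor
    · rw [proj_cyc, proj_descProd_T le_rfl, (hGk (m + 1)).1]
    · rw [descProd_succ, Module.End.mul_apply, proj_cyc_T, proj_descProd_T le_rfl,
        (hGk (m + 1)).2]
  refine ⟨_, hL.extend_mem hG hf 1 fun k _ => ?_, ?_⟩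
  · calc ((t * q) • (x 0 * cyc k (descProd T (k - 1) (G k)))).totalDegree
      _ ≤ (x 0 * cyc k (descProd T (k - 1) (G k))).totalDegree :=
          MvPolynomial.totalDegree_smul_le _ _
      _ ≤ (x 0).totalDegree + (cyc k (descProd T (k - 1) (G k))).totalDegree :=
          MvPolynomial.totalDegree_mul _ _
      _ ≤ 1 + (G k).totalDegree := add_le_add (totalDegree_x 0).le
          ((totalDegree_cyc_le _ _).trans (totalDegree_descProd_T_le _ _))
      _ ≤ (G (k + 1)).totalDegree + 1 := by
          rw [add_comm]
          exact Nat.add_le_add_right (totalDegree_le_of_mem_PInf (hL.le hG) k.le_succ) 1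
  · filter_upwards [eventually_gt_atTop 0] with k hk
    rw [extend_apply hf hk]
    obtain ⟨m, rfl⟩ := Nat.exists_eq_add_one.2 hk
    rw [limX_apply _ hk, Ytilde_zero_of_dvd (dvd_mul_right _ _), cherednik_x_zero_mul,
      Nat.add_sub_cancel]

theorem isCompatibleFrom_pr1_cyc (hL : IsDegreeClosed L) {n : ℕ} {A : ℕ → R}
    (hA : A ∈ PSym L n) : IsCompatibleFrom (n + 1) fun k => pr1 (cyc k (A k)) := by
  obtain ⟨hAL, hs⟩ := hL.mem_PSym_iff.1 hA
  have hAk := mem_PInf_iff.1 (hL.le hAL)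
  intro k hk
  obtain ⟨m, rfl⟩ := Nat.exists_eq_add_one.2 (n.succ_pos.trans_le hk)
  constructor
  · rw [← pr1_proj, proj_cyc, (hAk (m + 1)).1]
  · rw [← pr1_proj, ← hs m (m + 1 + 1) (by omega) le_rfl, proj_cyc_s, (hAk (m + 1)).2]

theorem exists_mem_PSym_pr1_cyc_eq (hL : IsDegreeClosed L) {n : ℕ} {A : ℕ → R}
    (hA : A ∈ PSym L n) : ∃ E ∈ PSym L (n + 1), ∀ k, n < k → pr1 (cyc k (A k)) = E k := by
  have hf := isCompatibleFrom_pr1_cyc hL hA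
  obtain ⟨hAL, hs⟩ := hL.mem_PSym_iff.1 hA
  have hE := hL.extend_mem hAL hf 0 fun k _ =>
    (totalDegree_pr1_le _).trans (totalDegree_cyc_le _ _)
  refine ⟨_, ⟨hE, fun i hi => ?_⟩, fun k hk => (extend_apply hf hk).symm⟩
  refine PInf_ext (hL.le (hL.limT_mem hE i)) (hL.le hE) ?_
  filter_upwards [eventually_ge_atTop (i + n + 3)] with k hk
  rw [limT_apply (hL.le hE) (by omega), extend_apply hf (by omega)]
  obtain ⟨j, rfl⟩ := Nat.exists_eq_add_one.2 (n.succ_pos.trans_le hi)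
  rw [← pr1_T (by omega), ← cyc_T (by omega),
    (T_eq_self_iff _ _).2 (hs j k (by omega) (by omega))]

theorem mem_PSym_of_Ytilde_zero_eq (hL : IsDegreeClosed L) {F H : ℕ → R} {n : ℕ}
    (hF : F ∈ PSym L n) (hH : H ∈ L) (hn : 0 < n)
    (h : ∀ᶠ k in atTop, Ytilde k 0 (F k) = H k) : H ∈ PSym L n := by
  refine ⟨hH, fun i hi => PInf_ext (hL.le (hL.limT_mem hH i)) (hL.le hH) ?_⟩
  filter_upwards [h, eventually_ge_atTop (i + 2)] with k hk hik
  rw [limT_apply (hL.le hH) hik, ← hk, ← Ytilde_zero_T (by omega) (by omega),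
    ← limT_apply (hL.le hF.1) hik, hF.2 i hi]

end FirstCherednikOperator

section LimitOperators

variable {L : Submodule K (ℕ → R)}

theorem PSym_mono {n m : ℕ} (h : n ≤ m) : PSym L n ≤ PSym L m :=
  fun _ hF => ⟨hF.1, fun i hi => hF.2 i (h.trans hi)⟩

theorem limT_comm (hL : IsDegreeClosed L) {F : ℕ → R} (hF : F ∈ L) {i j : ℕ} (h : i + 1 < j) :
    limT i (limT j F) = limT j (limT i F) := by
  have hi := hL.limT_mem hF i
  have hj := hL.limT_mem hF j
  refine PInf_ext (hL.le (hL.limT_mem hj i)) (hL.le (hL.limT_mem hi j)) ?_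
  filter_upwards [eventually_ge_atTop (j + 2)] with k hk
  rw [limT_apply (hL.le hj) (by omega), limT_apply (hL.le hF) (by omega),
    limT_apply (hL.le hi) (by omega), limT_apply (hL.le hF) (by omega), T_comm h]

theorem limT_limX_of_ne (hL : IsDegreeClosed L) {F : ℕ → R} (hF : F ∈ L) {i j : ℕ}
    (h₁ : j ≠ i) (h₂ : j ≠ i + 1) : limT i (limX j F) = limX j (limT i F) := by
  have hi := hL.limT_mem hF i
  have hj := hL.limX_mem hF j
  refine PInf_ext (hL.le (hL.limT_mem hj i)) (hL.le (hL.limX_mem hi j)) ?_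
  filter_upwards [eventually_ge_atTop (i + j + 2)] with k hk
  rw [limT_apply (hL.le hj) (by omega), limX_apply _ (by omega), limX_apply _ (by omega),
    limT_apply (hL.le hF) (by omega), T_x_mul_of_ne h₁ h₂]

theorem limT_mem_PSym (hL : IsDegreeClosed L) {F : ℕ → R} {n : ℕ} (hF : F ∈ PSym L n) {i : ℕ}
    (hi : i + 2 ≤ n) : limT i F ∈ PSym L n :=
  ⟨hL.limT_mem hF.1 i, fun j hj => by rw [← limT_comm hL hF.1 (by omega), hF.2 j hj]⟩

theorem limX_mem_PSym (hL : IsDegreeClosed L) {F : ℕ → R} {n : ℕ} (hF : F ∈ PSym L n) {i : ℕ}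
    (hi : i + 1 ≤ n) : limX i F ∈ PSym L n :=
  ⟨hL.limX_mem hF.1 i, fun j hj => by
    rw [limT_limX_of_ne hL hF.1 (by omega) (by omega), hF.2 j hj]⟩

theorem limT_mem_PAs (hL : IsDegreeClosed L) {F : ℕ → R} (hF : F ∈ PAs L) (i : ℕ) :
    limT i F ∈ PAs L := by
  obtain ⟨n, hF⟩ := hF
  exact ⟨_, limT_mem_PSym hL (PSym_mono (le_max_left n (i + 2)) hF) (le_max_right _ _)⟩

theorem limX_mem_PAs (hL : IsDegreeClosed L) {F : ℕ → R} (hF : F ∈ PAs L) (i : ℕ) :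
    limX i F ∈ PAs L := by
  obtain ⟨n, hF⟩ := hF
  exact ⟨_, limX_mem_PSym hL (PSym_mono (le_max_left n (i + 1)) hF) (le_max_right _ _)⟩

theorem ConvergesTo.map_limT (hL : IsDegreeClosed L) {f F : ℕ → R} (h : ConvergesTo L f F)
    (i : ℕ) : ConvergesTo L (fun k => T i (f k)) (limT i F) :=
  h.map (T i) (limT i) (fun _ hG => hL.limT_mem hG i) (fun _ hG => limT_mem_PAs hL hG i)
    fun G hG => by
      filter_upwards [eventually_ge_atTop (i + 2)] with k hk
      exact limT_apply (hL.le hG) hk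

theorem ConvergesTo.map_limX (hL : IsDegreeClosed L) {f F : ℕ → R} (h : ConvergesTo L f F)
    (i : ℕ) : ConvergesTo L (fun k => x i * f k) (limX i F) :=
  h.map (LinearMap.mulLeft K (x i)) (limX i) (fun _ hG => hL.limX_mem hG i)
    (fun _ hG => limX_mem_PAs hL hG i) fun G _ => by
      filter_upwards [eventually_gt_atTop i] with k hk
      exact limX_apply G hk

/-- The operator `𝒯_i` on the almost symmetric module. -/
def opT (hL : IsDegreeClosed L) (i : ℕ) : Module.End K (PAs L) :=
  (limT i).restrict fun _ hF => limT_mem_PAs hL hF i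

/-- The operator `𝒳_i` on the almost symmetric module. -/
def opX (hL : IsDegreeClosed L) (i : ℕ) : Module.End K (PAs L) :=
  (limX i).restrict fun _ hF => limX_mem_PAs hL hF i

theorem coe_opT (hL : IsDegreeClosed L) (i : ℕ) (F : PAs L) :
    (opT hL i F : ℕ → R) = limT i F := rfl

theorem coe_opX (hL : IsDegreeClosed L) (i : ℕ) (F : PAs L) :
    (opX hL i F : ℕ → R) = limX i F := rfl

theorem PAs_le_PInf (hL : IsDegreeClosed L) : PAs L ≤ PInf := (PAs_le L).trans hL.le

theorem PAs_ext (hL : IsDegreeClosed L) {F G : PAs L}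
    (h : ∀ᶠ k in atTop, (F : ℕ → R) k = (G : ℕ → R) k) : F = G :=
  Subtype.ext (PInf_ext (PAs_le_PInf hL F.2) (PAs_le_PInf hL G.2) h)

theorem opT_apply (hL : IsDegreeClosed L) {i k : ℕ} (h : i + 2 ≤ k) (F : PAs L) :
    (opT hL i F : ℕ → R) k = T i ((F : ℕ → R) k) :=
  limT_apply (PAs_le_PInf hL F.2) h

theorem opX_apply (hL : IsDegreeClosed L) {i k : ℕ} (h : i < k) (F : PAs L) :
    (opX hL i F : ℕ → R) k = x i * (F : ℕ → R) k :=
  limX_apply _ h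

theorem ascProd_opT_apply (hL : IsDegreeClosed L) {n k : ℕ} (h : n < k) (F : PAs L) :
    (ascProd (opT hL) n F : ℕ → R) k = ascProd T n ((F : ℕ → R) k) := by
  induction n generalizing F with
  | zero => rfl
  | succ n ih =>
    rw [ascProd_succ, Module.End.mul_apply, ih (by omega), opT_apply hL (by omega), ascProd_succ,
      Module.End.mul_apply]

/-- The additive group underlying the given module structure, in the form that makes the ring
structure of `Module.End K (PAs L)` available. -/
instance instAddCommGroupPAs : AddCommGroup (PAs L) := Module.addCommMonoidToAddCommGroup K

theorem isHecke_opT (hL : IsDegreeClosed L) : IsHecke t (opT hL) where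
  ne_zero := t_ne_zero
  commute_of_lt h := LinearMap.ext fun F => Subtype.ext (limT_comm hL (PAs_le L F.2) h)
  braid i := by
    refine LinearMap.ext fun F => PAs_ext hL ?_
    filter_upwards [eventually_ge_atTop (i + 3)] with k hk
    simp only [Module.End.mul_apply, opT_apply hL (show i + 2 ≤ k by omega),
      opT_apply hL (show i + 1 + 2 ≤ k by omega), T_braid]
  mul_self i := by
    refine LinearMap.ext fun F => PAs_ext hL ?_
    filter_upwards [eventually_ge_atTop (i + 2)] with k hk
    simp only [Module.End.mul_apply, LinearMap.add_apply, LinearMap.smul_apply,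
      Module.End.one_apply, Submodule.coe_add, Submodule.coe_smul, Pi.add_apply, Pi.smul_apply,
      opT_apply hL hk, T_T]

theorem opT_mul_opX_mul_opT (hL : IsDegreeClosed L) (i : ℕ) :
    opT hL i * opX hL (i + 1) * opT hL i = t • opX hL i := by
  refine LinearMap.ext fun F => PAs_ext hL ?_
  filter_upwards [eventually_ge_atTop (i + 2)] with k hk
  simp only [Module.End.mul_apply, LinearMap.smul_apply, Submodule.coe_smul, Pi.smul_apply]
  rw [opT_apply hL hk, opX_apply hL hk, opT_apply hL hk, opX_apply hL (by omega),
    T_x_succ_mul_eq_Tinv, Tinv_T]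

theorem commute_opT_opX (hL : IsDegreeClosed L) {i j : ℕ} (h₁ : j ≠ i) (h₂ : j ≠ i + 1) :
    Commute (opT hL i) (opX hL j) :=
  LinearMap.ext fun F => Subtype.ext (limT_limX_of_ne hL (PAs_le L F.2) h₁ h₂)

theorem commute_opX (hL : IsDegreeClosed L) (i j : ℕ) : Commute (opX hL i) (opX hL j) :=
  LinearMap.ext fun F => Subtype.ext <| funext fun k =>
    mul_left_comm (proj k (x i)) (proj k (x j)) ((F : ℕ → R) k)

theorem isFixed_opT_iff (hL : IsDegreeClosed L) {n : ℕ} {F : PAs L} :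
    IsFixed (opT hL) n F ↔ (F : ℕ → R) ∈ PSym L n :=
  ⟨fun h => ⟨PAs_le L F.2, fun i hi => congrArg Subtype.val (h i hi)⟩,
    fun h i hi => Subtype.ext (h.2 i hi)⟩

theorem isAlmostSymmetric_opT_opX (hL : IsDegreeClosed L) :
    IsAlmostSymmetric t (opT hL) (opX hL) where
  hecke := isHecke_opT hL
  mul_X_mul := opT_mul_opX_mul_opT hL
  commute_X := commute_opT_opX hL
  exists_isFixed F := F.2.imp fun _ => (isFixed_opT_iff hL).2
  exists_eq_add {n F} hF := by
    obtain ⟨A, hA, B, hB, h⟩ := exists_eq_add_limX hL ((isFixed_opT_iff hL).1 hF)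
    exact ⟨⟨A, n, hA⟩, ⟨B, n + 1, hB⟩, (isFixed_opT_iff hL).2 hA, (isFixed_opT_iff hL).2 hB,
      Subtype.ext h⟩

end LimitOperators

section LimitCherednikOperators

variable {L : Submodule K (ℕ → R)}

theorem exists_Ytilde_zero_ascProd_eq (hL : IsDegreeClosed L) {n : ℕ} {F : PAs L}
    (hF : IsFixed (opT hL) n F) :
    ∃ E ∈ PAs L,
      ∀ᶠ k in atTop, Ytilde k 0 ((ascProd (opT hL) n F : ℕ → R) k) = t ^ k • E k := by
  rw [isFixed_opT_iff] at hF
  obtain ⟨E, hE, h⟩ := exists_mem_PSym_pr1_cyc_eq hL hF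
  refine ⟨E, ⟨_, hE⟩, ?_⟩
  filter_upwards [eventually_gt_atTop n] with k hk
  have hfix : ∀ i, n ≤ i → i < k - 1 → T i ((F : ℕ → R) k) = (F : ℕ → R) k := fun i hi hik =>
    (T_eq_self_iff _ _).2 ((hL.mem_PSym_iff.1 hF).2 i k hi (by omega))
  rw [ascProd_opT_apply hL hk, Ytilde_zero_apply, cherednik_apply,
    TinvChain_ascProd_T_of_le (by omega) hfix, map_smul, h k hk]

theorem exists_mem_PAs_Ytilde_zero_eq (hL : IsDegreeClosed L) {F : ℕ → R} (hF : F ∈ PAs L)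
    (hdvd : ∀ᶠ k in atTop, x 0 ∣ F k) :
    ∃ H ∈ PAs L, ∀ᶠ k in atTop, Ytilde k 0 (F k) = H k := by
  obtain ⟨H, hH, h⟩ := exists_eventually_Ytilde_zero_eq hL (PAs_le L hF) hdvd
  obtain ⟨n, hF⟩ := hF
  exact ⟨H, ⟨_, mem_PSym_of_Ytilde_zero_eq hL (PSym_mono n.le_succ hF) hH n.succ_pos h⟩, h⟩

theorem eventually_x_zero_dvd_opX_zero (hL : IsDegreeClosed L) (F : PAs L) :
    ∀ᶠ k in atTop, x 0 ∣ (opX hL 0 F : ℕ → R) k := by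
  filter_upwards [eventually_gt_atTop 0] with k hk
  exact opX_apply hL hk F ▸ dvd_mul_right _ _

theorem exists_convergesTo_Ytilde_zero (hL : IsDegreeClosed L) (F : PAs L) :
    ∃ G : PAs L, ConvergesTo L (fun k => Ytilde k 0 ((F : ℕ → R) k)) (G : ℕ → R) := by
  obtain ⟨n, hn⟩ := (isAlmostSymmetric_opT_opX hL).exists_isFixed F
  obtain ⟨A, C, hA, rfl⟩ := (isAlmostSymmetric_opT_opX hL).exists_eq_ascProd_add hn
  obtain ⟨E, hE, hEA⟩ := exists_Ytilde_zero_ascProd_eq hL hA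
  obtain ⟨H, hH, hHC⟩ :=
    exists_mem_PAs_Ytilde_zero_eq hL (opX hL 0 C).2 (eventually_x_zero_dvd_opX_zero hL C)
  refine ⟨⟨H, hH⟩, .of_eventually_eq_add_t_pow (PAs_le L hH) hE ?_⟩
  filter_upwards [hEA, hHC] with k hEk hHk
  rw [Submodule.coe_add, Pi.add_apply, map_add, hEk, hHk, add_comm]

/-- The limit operator `𝒴_1` (usual numbering) on the almost symmetric module. -/
def opYZero (hL : IsDegreeClosed L) : Module.End K (PAs L) where
  toFun F := (exists_convergesTo_Ytilde_zero hL F).choose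
  map_add' F G := by
    refine Subtype.ext ((exists_convergesTo_Ytilde_zero hL (F + G)).choose_spec.unique hL.le ?_)
    refine ((exists_convergesTo_Ytilde_zero hL F).choose_spec.add
      (exists_convergesTo_Ytilde_zero hL G).choose_spec).congr (.of_forall fun k => ?_)
    exact (map_add (Ytilde k 0) _ _).symm
  map_smul' c F := by
    refine Subtype.ext ((exists_convergesTo_Ytilde_zero hL (c • F)).choose_spec.unique hL.le ?_)
    refine ((exists_convergesTo_Ytilde_zero hL F).choose_spec.smul c).congr
      (.of_forall fun k => ?_)
    exact (map_smul (Ytilde k 0) c _).symm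

theorem convergesTo_opYZero (hL : IsDegreeClosed L) (F : PAs L) :
    ConvergesTo L (fun k => Ytilde k 0 ((F : ℕ → R) k)) (opYZero hL F : ℕ → R) :=
  (exists_convergesTo_Ytilde_zero hL F).choose_spec

theorem opYZero_eq_of_convergesTo (hL : IsDegreeClosed L) {F G : PAs L}
    (h : ConvergesTo L (fun k => Ytilde k 0 ((F : ℕ → R) k)) (G : ℕ → R)) : opYZero hL F = G :=
  Subtype.ext ((convergesTo_opYZero hL F).unique hL.le h)

theorem commute_opT_opYZero (hL : IsDegreeClosed L) {i : ℕ} (hi : 0 < i) :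
    Commute (opT hL i) (opYZero hL) := by
  refine LinearMap.ext fun F => ?_
  rw [Module.End.mul_apply, Module.End.mul_apply]
  symm
  apply opYZero_eq_of_convergesTo hL
  rw [coe_opT hL i (opYZero hL F)]
  refine ((convergesTo_opYZero hL F).map_limT hL i).congr ?_
  filter_upwards [eventually_ge_atTop (i + 2)] with k hk
  rw [opT_apply hL hk, Ytilde_zero_T hi hk]

theorem opYZero_mul_opT_mul_opX (hL : IsDegreeClosed L) :
    opYZero hL * opT hL 0 * opX hL 0 = opX hL 1 * opYZero hL * opT hL 0 := by
  refine LinearMap.ext fun F => ?_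
  simp only [Module.End.mul_apply]
  apply opYZero_eq_of_convergesTo hL
  rw [coe_opX]
  refine ((convergesTo_opYZero hL (opT hL 0 F)).map_limX hL 1).congr ?_
  filter_upwards [eventually_ge_atTop 2] with k hk
  obtain ⟨m, rfl⟩ := Nat.exists_eq_add_of_le' hk
  rw [opT_apply hL hk, opT_apply hL hk, opX_apply hL (by omega), Ytilde_zero_T_zero_x_zero_mul]

theorem opYZero_ascProd (hL : IsDegreeClosed L) {n : ℕ} {F : PAs L}
    (hF : IsFixed (opT hL) n F) : opYZero hL (ascProd (opT hL) n F) = 0 := by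
  obtain ⟨E, hE, h⟩ := exists_Ytilde_zero_ascProd_eq hL hF
  refine opYZero_eq_of_convergesTo hL
    (.of_eventually_eq_add_t_pow (PAs_le L (0 : PAs L).2) hE ?_)
  filter_upwards [h] with k hk
  rw [hk, Submodule.coe_zero, Pi.zero_apply, zero_add]

theorem eventually_opYZero_eq (hL : IsDegreeClosed L) {F : PAs L}
    (h : ∀ᶠ k in atTop, x 0 ∣ (F : ℕ → R) k) :
    ∀ᶠ k in atTop, (opYZero hL F : ℕ → R) k = Ytilde k 0 ((F : ℕ → R) k) := by
  obtain ⟨H, hH, hHF⟩ := exists_mem_PAs_Ytilde_zero_eq hL F.2 h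
  rw [opYZero_eq_of_convergesTo hL (G := ⟨H, hH⟩) (.of_eventually_eq (PAs_le L hH) hHF)]
  exact hHF.mono fun _ => Eq.symm

theorem eventually_opYZero_eq_of_mul_dvd (hL : IsDegreeClosed L) {F : PAs L}
    (h : ∀ᶠ k in atTop, x 0 * x 1 ∣ (F : ℕ → R) k) :
    ∀ᶠ k in atTop, (opYZero hL F : ℕ → R) k = Ytilde k 0 ((F : ℕ → R) k) :=
  eventually_opYZero_eq hL (h.mono fun _ hk => (dvd_mul_right _ _).trans hk)

theorem eventually_mul_dvd_opT_zero (hL : IsDegreeClosed L) {F : PAs L}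
    (h : ∀ᶠ k in atTop, x 0 * x 1 ∣ (F : ℕ → R) k) :
    ∀ᶠ k in atTop, x 0 * x 1 ∣ (opT hL 0 F : ℕ → R) k := by
  filter_upwards [h, eventually_ge_atTop 2] with k hdvd hk
  exact opT_apply hL hk F ▸ x_zero_mul_x_one_dvd_T_zero hdvd

theorem eventually_mul_dvd_opYZero (hL : IsDegreeClosed L) {F : PAs L}
    (h : ∀ᶠ k in atTop, x 0 * x 1 ∣ (F : ℕ → R) k) :
    ∀ᶠ k in atTop, x 0 * x 1 ∣ (opYZero hL F : ℕ → R) k := by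
  filter_upwards [h, eventually_opYZero_eq_of_mul_dvd hL h, eventually_ge_atTop 2]
    with k hdvd hY hk
  obtain ⟨m, rfl⟩ := Nat.exists_eq_add_of_le' hk
  exact hY ▸ x_zero_mul_x_one_dvd_Ytilde_zero hdvd

theorem opYZero_opT_opYZero_opT (hL : IsDegreeClosed L) {F : PAs L}
    (h : ∀ᶠ k in atTop, x 0 * x 1 ∣ (F : ℕ → R) k) :
    opYZero hL (opT hL 0 (opYZero hL (opT hL 0 F))) =
      opT hL 0 (opYZero hL (opT hL 0 (opYZero hL F))) := by
  have hT := eventually_mul_dvd_opT_zero hL h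
  have hTYT := eventually_mul_dvd_opT_zero hL (eventually_mul_dvd_opYZero hL hT)
  have hTY := eventually_mul_dvd_opT_zero hL (eventually_mul_dvd_opYZero hL h)
  refine PAs_ext hL ?_
  filter_upwards [h, eventually_opYZero_eq_of_mul_dvd hL h, eventually_opYZero_eq_of_mul_dvd hL hT,
    eventually_opYZero_eq_of_mul_dvd hL hTYT, eventually_opYZero_eq_of_mul_dvd hL hTY,
    eventually_ge_atTop 2] with k hdvd hY hYT hYTYT hYTY hk
  simp only [hY, hYT, hYTYT, hYTY, opT_apply hL hk]
  obtain ⟨m, rfl⟩ := Nat.exists_eq_add_of_le' hk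
  exact Ytilde_zero_T_Ytilde_zero_T hdvd

theorem lie_opYZero_jucys_one_opX_opX (hL : IsDegreeClosed L) (F : PAs L) :
    ⁅opYZero hL, jucys t (opT hL) (opYZero hL) 1⁆ (opX hL 0 (opX hL 1 F)) = 0 := by
  have hdvd : ∀ᶠ k in atTop, x 0 * x 1 ∣ (opX hL 0 (opX hL 1 F) : ℕ → R) k := by
    filter_upwards [eventually_ge_atTop 2] with k hk
    rw [opX_apply hL (by omega), opX_apply hL (by omega), ← mul_assoc]
    exact dvd_mul_right _ _
  rw [jucys_succ, jucys_zero, Ring.lie_def]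
  simp only [LinearMap.sub_apply, Module.End.mul_apply, LinearMap.smul_apply, map_smul,
    opYZero_opT_opYZero_opT hL hdvd, sub_self]

/-- The limit operator `𝒴_{i+1}` (usual numbering) on the almost symmetric module. -/
def opY (hL : IsDegreeClosed L) : ℕ → Module.End K (PAs L) := jucys t (opT hL) (opYZero hL)

theorem convergesTo_opY (hL : IsDegreeClosed L) (i : ℕ) (F : PAs L) :
    ConvergesTo L (fun k => Ytilde k i ((F : ℕ → R) k)) (opY hL i F : ℕ → R) := by
  induction i generalizing F with
  | zero => exact convergesTo_opYZero hL F
  | succ i ih =>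
    refine (((ih (opT hL i F)).map_limT hL i).smul t⁻¹).congr ?_
    filter_upwards [eventually_ge_atTop (i + 2)] with k hk
    rw [opT_apply hL hk]
    rfl

theorem opY_eq_zero_of_isFixed (hL : IsDegreeClosed L) {n : ℕ} {F : PAs L}
    (hF : IsFixed (opT hL) n F) : opY hL n F = 0 := by
  obtain ⟨d, hd⟩ := exists_jucys_eq_mul_ascProd t (opT hL) (opYZero hL) n
  rw [opY, hd, Module.End.mul_apply, Module.End.mul_apply, opYZero_ascProd hL hF, map_zero]

theorem commute_opY (hL : IsDegreeClosed L) (i j : ℕ) : Commute (opY hL i) (opY hL j) :=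
  (isHecke_opT hL).jucys_commute (fun _ => commute_opT_opYZero hL)
    ((isAlmostSymmetric_opT_opX hL).jucys_commute_one (fun _ => commute_opT_opYZero hL)
      (lie_opYZero_jucys_one_opX_opX hL) fun _ _ => opY_eq_zero_of_isFixed hL) i j

end LimitCherednikOperators

section Representation

variable {L : Submodule K (ℕ → R)}

/-- The action of the generators of `ℋ⁺` on the almost symmetric module. -/
def genAction (hL : IsDegreeClosed L) : Gen → Module.End K (PAs L)
  | Gen.T i => opT hL i
  | Gen.X i => opX hL i
  | Gen.Y i => opY hL i

theorem lift_fT (hL : IsDegreeClosed L) (i : ℕ) :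
    FreeAlgebra.lift K (genAction hL) (fT i) = opT hL i := FreeAlgebra.lift_ι_apply _ _

theorem lift_fX (hL : IsDegreeClosed L) (i : ℕ) :
    FreeAlgebra.lift K (genAction hL) (fX i) = opX hL i := FreeAlgebra.lift_ι_apply _ _

theorem lift_fY (hL : IsDegreeClosed L) (i : ℕ) :
    FreeAlgebra.lift K (genAction hL) (fY i) = opY hL i := FreeAlgebra.lift_ι_apply _ _

theorem lift_fTinv (hL : IsDegreeClosed L) (i : ℕ) :
    FreeAlgebra.lift K (genAction hL) (fTinv i) = heckeInv t (opT hL) i := by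
  rw [fTinv, map_smul, map_add, lift_fT, AlgHom.commutes, heckeInv,
    Algebra.algebraMap_eq_smul_one]

theorem lift_eq_of_rel (hL : IsDegreeClosed L) {a b : Free} (h : Rel a b) :
    FreeAlgebra.lift K (genAction hL) a = FreeAlgebra.lift K (genAction hL) b := by
  have hT := isHecke_opT hL
  induction h with
  | T_comm i j h => simp only [map_mul, lift_fT, (hT.commute h).eq]
  | braid i => simp only [map_mul, lift_fT, hT.braid i]
  | quadratic i =>
    simp only [map_mul, map_sub, map_add, map_one, map_zero, lift_fT, AlgHom.commutes]
    exact hT.sub_one_mul_add_algebraMap i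
  | X_succ i =>
    simp only [map_smul, map_mul, lift_fTinv, lift_fX]
    rw [← smul_mul_assoc, ← mul_smul_comm, ← opT_mul_opX_mul_opT, mul_assoc (opT hL i),
      hT.heckeInv_mul_cancel_left, mul_assoc, hT.mul_heckeInv, mul_one]
  | T_X i j h₁ h₂ => simp only [map_mul, lift_fT, lift_fX, (commute_opT_opX hL h₁ h₂).eq]
  | X_comm i j => simp only [map_mul, lift_fX, (commute_opX hL i j).eq]
  | Y_succ i =>
    simp only [map_smul, map_mul, lift_fT, lift_fY]
    rfl
  | T_Y i j h₁ h₂ =>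
    simp only [map_mul, lift_fT, lift_fY]
    exact hT.commute_jucys (fun _ => commute_opT_opYZero hL) h₁ h₂
  | Y_comm i j => simp only [map_mul, lift_fY, (commute_opY hL i j).eq]
  | cross =>
    simp only [map_mul, lift_fT, lift_fX, lift_fY]
    exact opYZero_mul_opT_mul_opX hL

/-- The representation of `ℋ⁺` on the almost symmetric module by the limit operators. -/
def limRep (hL : IsDegreeClosed L) : HPlus →ₐ[K] Module.End K (PAs L) :=
  RingQuot.liftAlgHom K ⟨FreeAlgebra.lift K (genAction hL), fun _ _ h => lift_eq_of_rel hL h⟩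

theorem limRep_mk (hL : IsDegreeClosed L) (a : Free) :
    limRep hL (HPlus.mk a) = FreeAlgebra.lift K (genAction hL) a :=
  RingQuot.liftAlgHom_mkAlgHom_apply K _ _ a

theorem limRep_T (hL : IsDegreeClosed L) (i : ℕ) : limRep hL (HPlus.T i) = opT hL i :=
  (limRep_mk hL _).trans (lift_fT hL i)

theorem limRep_X (hL : IsDegreeClosed L) (i : ℕ) : limRep hL (HPlus.X i) = opX hL i :=
  (limRep_mk hL _).trans (lift_fX hL i)

theorem limRep_Y (hL : IsDegreeClosed L) (i : ℕ) : limRep hL (HPlus.Y i) = opY hL i :=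
  (limRep_mk hL _).trans (lift_fY hL i)

theorem actsByLimitOperators_limRep (hL : IsDegreeClosed L) :
    ActsByLimitOperators L (limRep hL) := fun i F => by
  rw [limRep_T, limRep_X, limRep_Y]
  exact ⟨coe_opT hL i F, coe_opX hL i F, convergesTo_opY hL i F⟩

theorem HPlus.algHom_ext {A : Type*} [Semiring A] [Algebra K A] {ρ σ : HPlus →ₐ[K] A}
    (hT : ∀ i, ρ (HPlus.T i) = σ (HPlus.T i)) (hX : ∀ i, ρ (HPlus.X i) = σ (HPlus.X i))
    (hY : ∀ i, ρ (HPlus.Y i) = σ (HPlus.Y i)) : ρ = σ := by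
  refine RingQuot.ringQuot_ext' K (s := Rel) ρ σ (FreeAlgebra.hom_ext (funext fun g => ?_))
  cases g with
  | T i => exact hT i
  | X i => exact hX i
  | Y i => exact hY i

theorem ActsByLimitOperators.unique (hL : L ≤ PInf) {ρ σ : HPlus →ₐ[K] Module.End K (PAs L)}
    (hρ : ActsByLimitOperators L ρ) (hσ : ActsByLimitOperators L σ) : ρ = σ :=
  HPlus.algHom_ext
    (fun i => LinearMap.ext fun F => Subtype.ext ((hρ i F).1.trans (hσ i F).1.symm))
    (fun i => LinearMap.ext fun F => Subtype.ext ((hρ i F).2.1.trans (hσ i F).2.1.symm))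
    fun i => LinearMap.ext fun F => Subtype.ext ((hρ i F).2.2.unique hL (hσ i F).2.2)

end Representation

end StableDAHA

end

theorem mainTheorem1_general {L : Submodule StableDAHA.K (ℕ → StableDAHA.R)}
    (hL : StableDAHA.IsDegreeClosed L) :
    ∃! ρ : StableDAHA.HPlus →ₐ[StableDAHA.K] Module.End StableDAHA.K (StableDAHA.PAs L),
      StableDAHA.ActsByLimitOperators L ρ :=
  ⟨_, StableDAHA.actsByLimitOperators_limRep hL,
    fun _ hρ => hρ.unique hL.le (StableDAHA.actsByLimitOperators_limRep hL)⟩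

/-- The limit operators `𝒯_i`, `𝒳_i`, `𝒴_i` define an `ℋ⁺`-module structure on the almost symmetric
module, both for the inverse limit of rings and for the inverse limit of graded rings. -/
theorem mainTheorem1 :
    (∃! ρ : StableDAHA.HPlus →ₐ[StableDAHA.K]
        Module.End StableDAHA.K (StableDAHA.PAs StableDAHA.PInf),
      StableDAHA.ActsByLimitOperators StableDAHA.PInf ρ) ∧
    (∃! ρ : StableDAHA.HPlus →ₐ[StableDAHA.K]
        Module.End StableDAHA.K (StableDAHA.PAs StableDAHA.PInfGr),
      StableDAHA.ActsByLimitOperators StableDAHA.PInfGr ρ) :=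
  ⟨mainTheorem1_general StableDAHA.isDegreeClosed_PInf,
    mainTheorem1_general StableDAHA.isDegreeClosed_PInfGr⟩
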